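/- **Notation.** Let $\mathcal F=\{0,1\}^n$, $[n]=\{1,\dots,n\}$. For $S,T,U\subseteq[n]$ and an integer $r\ge 0$ put $S|_1=\{x\in\mathcal F: x_i=1\ \forall i\in S\}$, $T|_0=\{x\in\mathcal F:x_i=0\ \forall i\in T\}$, $U|_{<r}=\{x\in\mathcal F:\sum_{i\in U}x_i\le r-1\}$; write $i|_t$ for $\{i\}|_t$. For $P\subseteq[0,1]^n$ let $P_I=\operatorname{conv}(P\cap\mathcal F)$ and $K(P)=\{(\lambda,\lambda x):\lambda\ge0,\ x\in P\}$. For a vector $y$ indexed by subsets of $\mathcal F$ let $\hat x(y)=(y_{\mathcal F},y_{1|_1},\dots,y_{n|_1})$. Let $P=\{x\in[0,1]^n:Ax\le b\}$ with $A\ge0$, $b>0$, and let $k\ge1$. A set $O\subseteq[n]$ is a *$k$-small obstruction* if for some row $A^i$: $O\subseteq\operatorname{supp}(A^i)$, $\sum_{j\in O}A^i_j>b_i$, and $|O|\le k+1$ or $|O|\ge|\operatorname{supp}(A^i)|-(k+1)$. Let $\mathcal O_k(P)$ be the set of $x\in P$ with $\sum_{i\in O}x_i\le|O|-1$ for all $k$-small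 obstructions $O$. Each collection of at most $k+1$ distinct $k$-small obstructions *generates* the set of all indices that lie in at least two of its members. **Base constraints** on a vector $y$ indexed by a collection $\mathcal A'$ of subsets of $\mathcal F$: $0\le y_\alpha\le y_{\mathcal F}$ for all $\alpha\in\mathcal A'$; $\hat x(y)\in K(\mathcal O_k(P))$; $y_{i|_1}+y_{i|_0}=y_{\mathcal F}$ for all $i$; for each $\alpha\in\mathcal A'$ of the form $S|_1\cap T|_0$: $y_{i|_1}\ge y_\alpha$ $(i\in S)$, $y_{i|_0}\ge y_\alpha$ $(i\in T)$, and $\sum_{i\in S}y_{i|_1}+\sum_{i\in T}y_{i|_0}-y_\alpha\le(|S|+|T|-1)y_{\mathcal F}$; for each $\alpha\in\mathcal A'$ of the form $S|_1\cap T|_0\cap U|_{<r}$: $y_{i|_1}\ge y_\alpha$ $(i\in S)$, $y_{i|_0}\ge y_\alpha$ $(i\in T)$, and $\sum_{i\in U}y_{i|_0}\ge(|U|-(r-1))y_\alpha$. **The operator $\mathrm{BZ}'^k$.** *Walls* are the sets generated by at most $k+1$ distinct $k$-small obstructions, and all singletons. A *tier* is a subset of a union of $k$ walls. $\mathcal A'$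 consists, for every tier $S$, of $(S\setminus T)|_1\cap T|_0$ for $T\subseteq S$, $|T|\le k$, and of $(S\setminus(T\cup U))|_1\cap T|_0\cap U|_{<|U|-(k-|T|)}$ for disjoint $T,U\subseteq S$ with $|T|<k<|U|+|T|$. $\mathrm{BZ}'^k(P)$ is the set of all $x\in\mathbb R^n$ for which there is a symmetric real matrix $Y$ indexed by $\mathcal A'$ with $Y[\mathcal F,\mathcal F]=1$ and $\hat x(Ye_{\mathcal F})=(1,x)$ such that: every column $y$ of $Y$ satisfies the base constraints, $y_{S|_1\cap T|_0}+y_{(S\cup\{i\})|_1\cap(T\setminus\{i\})|_0}=y_{S|_1\cap(T\setminus\{i\})|_0}$ for $S|_1\cap T|_0\in\mathcal A'$ and $i\in T$, and, for pairwise disjoint $S,T,U$ with $S|_1\cap T|_0\cap U|_{<r}\in\mathcal A'$, $y_{S|_1\cap T|_0\cap U|_{<r}}=y_{S|_1\cap T|_0}-\sum_{U'\subseteq U,\,|U'|\ge r}y_{(S\cup U')|_1\cap(T\cup(U\setminus U'))|_0}$; $Y[\alpha,\beta]=0$ whenever $\operatorname{conv}(\alpha)\cap\operatorname{conv}(\beta)\cap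 P=\emptyset$; and $Y[\alpha_1,\beta_1]=Y[\alpha_2,\beta_2]$ whenever $\alpha_1\cap\beta_1=\alpha_2\cap\beta_2$. **The operator $\mathrm{BZ}^k$.** *Walls* are only the sets generated by at most $k+1$ distinct $k$-small obstructions. $\mathcal A'$ consists of $\mathcal F$, all $i|_1$, $i|_0$, and, for all walls $W_1,\dots,W_\ell$ with $\ell\le k$ and all $T_i\subseteq W_i$ with $\sum_{i\le\ell}|T_i|\le k$, of $\big(\bigcup_{i\le\ell}W_i\setminus T_i\big)|_1\cap\big(\bigcup_{i\le\ell}T_i\big)|_0$, and, if moreover $\ell\ge1$, $\sum_{i\le\ell}|T_i|=k$ and $T_\ell\subsetneq W_\ell$, of $\alpha_0\cap W_\ell|_{<|W_\ell|-|T_\ell|}$, where $\alpha_0:=\big(\bigcup_{i<\ell}W_i\setminus T_i\big)|_1\cap\big(\bigcup_{i<\ell}T_i\big)|_0$. $\mathrm{BZ}^k(P)$ is the set of all $x\in\mathbb R^n$ for which there is a symmetric real matrix $Y$ indexed by $\mathcal A'$ with $Y[\mathcal F,\mathcal F]=1$ and $\hat x(Ye_{\mathcal F})=(1,x)$ such that: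 every column $y$ satisfies the base constraints and, for all walls $W_1,\dots,W_\ell$ $(1\le\ell\le k)$ and $T_i\subseteq W_i$ $(i<\ell)$ with $\rho:=k-\sum_{i<\ell}|T_i|\ge0$, in case $|W_\ell|\le\rho$ $$\sum_{U\subseteq W_\ell}y_{\alpha_0\cap(W_\ell\setminus U)|_1\cap U|_0}=y_{\alpha_0},$$ and otherwise $$\sum_{U\subseteq W_\ell,\,|U|\le\rho}y_{\alpha_0\cap(W_\ell\setminus U)|_1\cap U|_0}+y_{\alpha_0\cap W_\ell|_{<|W_\ell|-\rho}}=y_{\alpha_0};$$ $Y[\alpha,\beta]=0$ whenever $\alpha\cap\beta=\emptyset$ or $\alpha\cap\beta\subseteq O|_1$ for some $k$-small obstruction $O$; and $Y[\alpha_1,\beta_1]=Y[\alpha_2,\beta_2]$ whenever $\alpha_1\cap\beta_1=\alpha_2\cap\beta_2$. For $\Gamma\in\{\mathrm{BZ}',\mathrm{BZ}\}$ the *$\Gamma$-rank* of $P$ is the smallest integer $k\ge1$ with $\Gamma^k(P)=P_I$. **Theorem.** Let $n\ge3$ and let $\mathrm{FRAC}(K_n)=\{x\in[0,1]^n:x_i+x_j\le1\text{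 for all }1\le i<j\le n\}$, described by these edge inequalities. Then the $\mathrm{BZ}'$-rank of $\mathrm{FRAC}(K_n)$ exists and lies between $\lceil n/2\rceil-2$ and $\lceil (n+1)/2\rceil$, and the same holds for the $\mathrm{BZ}$-rank. -/

import Mathlib

/-!
Lift-and-project operators of Bienstock--Zuckerberg type for polytopes
`{x ∈ [0,1]^V : A x ≤ b}` with `A ≥ 0` and `b > 0`, and the fractional stable set polytope.

Subsets of the hypercube `{0,1}^V` index the rows and columns of the lifted matrices.
-/

noncomputable section

namespace LiftProject

variable {V : Type*} [Fintype V] [DecidableEq V] {ι : Type*}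

/-! ### The hypercube and its subsets -/

/-- The vertex set `{0,1}^V` of the unit cube. -/
def cubeVertices (V : Type*) : Set (V → ℝ) := {x | ∀ i, x i = 0 ∨ x i = 1}

/-- The set `S|₁` of all 0-1 vectors that are one on `S`. -/
def ones (S : Finset V) : Set (V → ℝ) := {x | x ∈ cubeVertices V ∧ ∀ i ∈ S, x i = 1}

/-- The set `T|₀` of all 0-1 vectors that are zero on `T`. -/
def zeros (T : Finset V) : Set (V → ℝ) := {x | x ∈ cubeVertices V ∧ ∀ i ∈ T, x i = 0}

/-- The set `U|_{<r}` of all 0-1 vectors with at most `r - 1` ones on `U`. -/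
def below (U : Finset V) (r : ℕ) : Set (V → ℝ) :=
  {x | x ∈ cubeVertices V ∧ ∑ i ∈ U, x i ≤ (r : ℝ) - 1}

/-- The integer hull `P_I`. -/
def integerHull (P : Set (V → ℝ)) : Set (V → ℝ) := convexHull ℝ (P ∩ cubeVertices V)

/-- The cone `K(P) = {(c, c x) : c ≥ 0, x ∈ P}`. -/
def cone (P : Set (V → ℝ)) : Set (ℝ × (V → ℝ)) :=
  {p | ∃ c : ℝ, 0 ≤ c ∧ ∃ x ∈ P, p = (c, c • x)}

/-- The part of a lifted vector indexed by the whole cube and by the sets `i|₁`. -/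
def hat (y : Set (V → ℝ) → ℝ) : ℝ × (V → ℝ) :=
  (y (cubeVertices V), fun i => y (ones {i}))

/-! ### Refinement -/

/-- The polytope `{x ∈ [0,1]^V : A x ≤ b}`. -/
def polytope (A : Matrix ι V ℝ) (b : ι → ℝ) : Set (V → ℝ) :=
  {x | (∀ v, 0 ≤ x v ∧ x v ≤ 1) ∧ ∀ i, ∑ v, A i v * x v ≤ b i}

open Classical in
/-- The support of row `i` of `A`. -/
def rowSupport (A : Matrix ι V ℝ) (i : ι) : Finset V := Finset.univ.filter fun j => A i j ≠ 0

/-- `O` is a `k`-small obstruction of the system `A x ≤ b`. -/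
def IsObstruction (k : ℕ) (A : Matrix ι V ℝ) (b : ι → ℝ) (O : Finset V) : Prop :=
  ∃ i, O ⊆ rowSupport A i ∧ b i < ∑ j ∈ O, A i j ∧
    (O.card ≤ k + 1 ∨ (rowSupport A i).card ≤ O.card + (k + 1))

/-- The refined relaxation `O_k(P)`. -/
def refined (k : ℕ) (A : Matrix ι V ℝ) (b : ι → ℝ) : Set (V → ℝ) :=
  {x | x ∈ polytope A b ∧
    ∀ O, IsObstruction k A b O → ∑ i ∈ O, x i ≤ (O.card : ℝ) - 1}

/-- The indices that lie in at least two members of the collection `C`. -/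
def overlap (C : Finset (Finset V)) : Finset V :=
  Finset.univ.filter fun v => ∃ O ∈ C, ∃ O' ∈ C, O ≠ O' ∧ v ∈ O ∧ v ∈ O'

/-- Walls of the operator `BZ`: generated by at most `k + 1` obstructions. -/
def IsWall (k : ℕ) (A : Matrix ι V ℝ) (b : ι → ℝ) (W : Finset V) : Prop :=
  ∃ C : Finset (Finset V), (∀ O ∈ C, IsObstruction k A b O) ∧ C.card ≤ k + 1 ∧ W = overlap C

/-! ### Constraints shared by both operators -/

/-- The constraints on a column `y` that `BZ'` and `BZ` have in common, where `Idx` is the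
collection of variables and `Q` the refined relaxation. -/
structure IsBaseColumn (Idx : Set (Set (V → ℝ))) (Q : Set (V → ℝ))
    (y : Set (V → ℝ) → ℝ) : Prop where
  nonneg : ∀ α ∈ Idx, 0 ≤ y α
  le_total : ∀ α ∈ Idx, y α ≤ y (cubeVertices V)
  hat_mem : hat y ∈ cone Q
  one_add_zero : ∀ i : V, y (ones {i}) + y (zeros {i}) = y (cubeVertices V)
  le_one : ∀ S T : Finset V, ones S ∩ zeros T ∈ Idx → ∀ i ∈ S,
    y (ones S ∩ zeros T) ≤ y (ones {i})
  le_zero : ∀ S T : Finset V, ones S ∩ zeros T ∈ Idx → ∀ i ∈ T,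
    y (ones S ∩ zeros T) ≤ y (zeros {i})
  union_bound : ∀ S T : Finset V, ones S ∩ zeros T ∈ Idx →
    ∑ i ∈ S, y (ones {i}) + ∑ i ∈ T, y (zeros {i}) - y (ones S ∩ zeros T) ≤
      ((S.card : ℝ) + (T.card : ℝ) - 1) * y (cubeVertices V)
  below_le_one : ∀ (S T U : Finset V) (r : ℕ), ones S ∩ zeros T ∩ below U r ∈ Idx → ∀ i ∈ S,
    y (ones S ∩ zeros T ∩ below U r) ≤ y (ones {i})
  below_le_zero : ∀ (S T U : Finset V) (r : ℕ), ones S ∩ zeros T ∩ below U r ∈ Idx → ∀ i ∈ T,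
    y (ones S ∩ zeros T ∩ below U r) ≤ y (zeros {i})
  below_count : ∀ (S T U : Finset V) (r : ℕ), ones S ∩ zeros T ∩ below U r ∈ Idx →
    ((U.card : ℝ) - ((r : ℝ) - 1)) * y (ones S ∩ zeros T ∩ below U r) ≤ ∑ i ∈ U, y (zeros {i})

/-! ### The operator `BZ'` -/

/-- Walls of `BZ'`: the walls of `BZ` together with all singletons. -/
def IsWallPrime (k : ℕ) (A : Matrix ι V ℝ) (b : ι → ℝ) (W : Finset V) : Prop :=
  IsWall k A b W ∨ ∃ v, W = {v}

/-- Tiers of `BZ'`: all subsets of unions of `k` walls. -/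
def IsTierPrime (k : ℕ) (A : Matrix ι V ℝ) (b : ι → ℝ) (S : Finset V) : Prop :=
  ∃ W : Fin k → Finset V, (∀ j, IsWallPrime k A b (W j)) ∧ S ⊆ Finset.univ.biUnion W

/-- The variables generated by `BZ'^k`. -/
def varsPrime (k : ℕ) (A : Matrix ι V ℝ) (b : ι → ℝ) : Set (Set (V → ℝ)) :=
  {α | ∃ S, IsTierPrime k A b S ∧
    ((∃ T, T ⊆ S ∧ T.card ≤ k ∧ α = ones (S \ T) ∩ zeros T) ∨
     (∃ T U, T ⊆ S ∧ U ⊆ S ∧ Disjoint U T ∧ T.card < k ∧ k < U.card + T.card ∧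
        α = ones (S \ (T ∪ U)) ∩ zeros T ∩ below U (U.card - (k - T.card))))}

/-- The column constraints of `BZ'^k`. All members of `varsPrime` are nonempty, and tiers are
closed under subsets, so each index occurring below is again a member of `varsPrime`. -/
structure IsColumnPrime (k : ℕ) (A : Matrix ι V ℝ) (b : ι → ℝ) (y : Set (V → ℝ) → ℝ) : Prop
    extends IsBaseColumn (varsPrime k A b) (refined k A b) y where
  split : ∀ S T : Finset V, ones S ∩ zeros T ∈ varsPrime k A b → ∀ i ∈ T,
    y (ones S ∩ zeros T) + y (ones (insert i S) ∩ zeros (T.erase i)) =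
      y (ones S ∩ zeros (T.erase i))
  below_eq : ∀ (S T U : Finset V) (r : ℕ), Disjoint S T → Disjoint S U → Disjoint T U →
    ones S ∩ zeros T ∩ below U r ∈ varsPrime k A b →
    y (ones S ∩ zeros T ∩ below U r) = y (ones S ∩ zeros T) -
      ∑ U' ∈ U.powerset.filter (fun U' => r ≤ U'.card),
        y (ones (S ∪ U') ∩ zeros (T ∪ (U \ U')))

/-- The lifted set of `BZ'^k`. A matrix with index set `varsPrime` is given as a function on all
pairs of sets, of which only the entries with both indices in `varsPrime` matter. -/
structure LiftPrime (k : ℕ) (A : Matrix ι V ℝ) (b : ι → ℝ)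
    (Y : Set (V → ℝ) → Set (V → ℝ) → ℝ) : Prop where
  symm : ∀ α ∈ varsPrime k A b, ∀ β ∈ varsPrime k A b, Y α β = Y β α
  total : Y (cubeVertices V) (cubeVertices V) = 1
  column : ∀ β ∈ varsPrime k A b, IsColumnPrime k A b fun α => Y α β
  eq_zero : ∀ α ∈ varsPrime k A b, ∀ β ∈ varsPrime k A b,
    convexHull ℝ α ∩ convexHull ℝ β ∩ polytope A b = ∅ → Y α β = 0
  consistent : ∀ α₁ ∈ varsPrime k A b, ∀ β₁ ∈ varsPrime k A b,
    ∀ α₂ ∈ varsPrime k A b, ∀ β₂ ∈ varsPrime k A b, α₁ ∩ β₁ = α₂ ∩ β₂ → Y α₁ β₁ = Y α₂ β₂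

/-- The relaxation `BZ'^k(P)` of `P = {x ∈ [0,1]^V : A x ≤ b}`. -/
def bzPrime (k : ℕ) (A : Matrix ι V ℝ) (b : ι → ℝ) : Set (V → ℝ) :=
  {x | ∃ Y, LiftPrime k A b Y ∧ hat (fun α => Y α (cubeVertices V)) = (1, x)}

/-! ### The operator `BZ` -/

/-- The union of the sets `W i \ T i`. -/
def onePart {l : ℕ} (W T : Fin l → Finset V) : Finset V :=
  Finset.univ.biUnion fun i => W i \ T i

/-- The union of the sets `T i`. -/
def zeroPart {l : ℕ} (T : Fin l → Finset V) : Finset V := Finset.univ.biUnion T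

/-- `W` is a tuple of walls, each with a chosen subset `T i ⊆ W i`, and at most `k` elements are
chosen altogether. -/
def IsChoice (k : ℕ) (A : Matrix ι V ℝ) (b : ι → ℝ) {l : ℕ} (W T : Fin l → Finset V) : Prop :=
  (∀ i, IsWall k A b (W i)) ∧ (∀ i, T i ⊆ W i) ∧ ∑ i, (T i).card ≤ k

/-- The variables generated by `BZ^k`; a tier is a union of at most `k` walls. In the last clause
the tuple of walls is split into its initial part `W` and its last member `W'`. -/
def vars (k : ℕ) (A : Matrix ι V ℝ) (b : ι → ℝ) : Set (Set (V → ℝ)) :=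
  {α | α = cubeVertices V ∨ (∃ i, α = ones {i}) ∨ (∃ i, α = zeros {i}) ∨
    (∃ l, l ≤ k ∧ ∃ W T : Fin l → Finset V, IsChoice k A b W T ∧
      α = ones (onePart W T) ∩ zeros (zeroPart T)) ∨
    (∃ l, l + 1 ≤ k ∧ ∃ (W T : Fin l → Finset V) (W' T' : Finset V), IsChoice k A b W T ∧
      IsWall k A b W' ∧ T' ⊂ W' ∧ ∑ i, (T i).card + T'.card = k ∧
      α = ones (onePart W T) ∩ zeros (zeroPart T) ∩ below W' (W'.card - T'.card))}

/-- The column constraints of `BZ^k`. The last two say that the values on a last wall `W'`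
partition the set given by the walls before it. -/
structure IsColumn (k : ℕ) (A : Matrix ι V ℝ) (b : ι → ℝ) (y : Set (V → ℝ) → ℝ) : Prop
    extends IsBaseColumn (vars k A b) (refined k A b) y where
  full_sum : ∀ l, l + 1 ≤ k → ∀ (W T : Fin l → Finset V) (W' : Finset V), IsChoice k A b W T →
    IsWall k A b W' → W'.card + ∑ i, (T i).card ≤ k →
    ∑ U ∈ W'.powerset,
        y (ones (onePart W T) ∩ zeros (zeroPart T) ∩ (ones (W' \ U) ∩ zeros U)) =
      y (ones (onePart W T) ∩ zeros (zeroPart T))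
  partial_sum : ∀ l, l + 1 ≤ k → ∀ (W T : Fin l → Finset V) (W' : Finset V),
    IsChoice k A b W T → IsWall k A b W' → k < W'.card + ∑ i, (T i).card →
    ∑ U ∈ W'.powerset.filter (fun U => U.card ≤ k - ∑ i, (T i).card),
        y (ones (onePart W T) ∩ zeros (zeroPart T) ∩ (ones (W' \ U) ∩ zeros U)) +
      y (ones (onePart W T) ∩ zeros (zeroPart T) ∩
          below W' (W'.card - (k - ∑ i, (T i).card))) =
      y (ones (onePart W T) ∩ zeros (zeroPart T))

/-- The lifted set of `BZ^k`; again only entries with both indices in `vars` matter. -/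
structure Lift (k : ℕ) (A : Matrix ι V ℝ) (b : ι → ℝ)
    (Y : Set (V → ℝ) → Set (V → ℝ) → ℝ) : Prop where
  symm : ∀ α ∈ vars k A b, ∀ β ∈ vars k A b, Y α β = Y β α
  total : Y (cubeVertices V) (cubeVertices V) = 1
  column : ∀ β ∈ vars k A b, IsColumn k A b fun α => Y α β
  eq_zero : ∀ α ∈ vars k A b, ∀ β ∈ vars k A b,
    (α ∩ β = ∅ ∨ ∃ O, IsObstruction k A b O ∧ α ∩ β ⊆ ones O) → Y α β = 0
  consistent : ∀ α₁ ∈ vars k A b, ∀ β₁ ∈ vars k A b,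
    ∀ α₂ ∈ vars k A b, ∀ β₂ ∈ vars k A b, α₁ ∩ β₁ = α₂ ∩ β₂ → Y α₁ β₁ = Y α₂ β₂

/-- The relaxation `BZ^k(P)` of `P = {x ∈ [0,1]^V : A x ≤ b}`. -/
def bz (k : ℕ) (A : Matrix ι V ℝ) (b : ι → ℝ) : Set (V → ℝ) :=
  {x | ∃ Y, Lift k A b Y ∧ hat (fun α => Y α (cubeVertices V)) = (1, x)}

/-! ### Rank, and the fractional stable set polytope -/

/-- `r` is the rank of `P` for the hierarchy `Γ 1, Γ 2, ...` of relaxations of `P`: the smallest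
`k ≥ 1` for which `Γ k` is the integer hull of `P`. -/
def IsRank (Γ : ℕ → Set (V → ℝ)) (P : Set (V → ℝ)) (r : ℕ) : Prop :=
  IsLeast {k | 1 ≤ k ∧ Γ k = integerHull P} r

/-- The fractional stable set polytope of a graph. -/
def frac (G : SimpleGraph V) : Set (V → ℝ) :=
  {x | (∀ v, 0 ≤ x v ∧ x v ≤ 1) ∧ ∀ u v, G.Adj u v → x u + x v ≤ 1}

/-- The coefficient matrix of the edge inequalities `x u + x v ≤ 1` (one row per edge). -/
def edgeMatrix (G : SimpleGraph V) : Matrix G.edgeSet V ℝ :=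
  fun e v => if v ∈ (e : Sym2 V) then 1 else 0

/-- The right-hand side of the edge inequalities. -/
def edgeRhs (G : SimpleGraph V) : G.edgeSet → ℝ := fun _ => 1

/-- The edge inequalities describe the fractional stable set polytope. -/
theorem polytope_edgeMatrix (G : SimpleGraph V) :
    polytope (edgeMatrix G) (edgeRhs G) = frac G := by
  have key : ∀ (x : V → ℝ) (u v : V) (h : G.Adj u v),
      ∑ w, edgeMatrix G ⟨s(u, v), h⟩ w * x w = x u + x v := by
    intro x u v h
    have hne : u ≠ v := h.ne
    have h1 : ∀ w, edgeMatrix G ⟨s(u, v), h⟩ w * x w =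
        (if w = u then x w else 0) + (if w = v then x w else 0) := by
      intro w
      by_cases h1 : w = u
      · subst h1
        simp [edgeMatrix, hne]
      · by_cases h2 : w = v
        · subst h2
          simp [edgeMatrix, h1]
        · simp [edgeMatrix, h1, h2]
    simp [h1, Finset.sum_add_distrib]
  ext x
  constructor
  · rintro ⟨hx, h⟩
    refine ⟨hx, fun u v huv => ?_⟩
    have := h ⟨s(u, v), huv⟩
    rw [key] at this
    exact this
  · rintro ⟨hx, h⟩
    refine ⟨hx, ?_⟩
    rintro ⟨e, he⟩
    induction e with
    | h u v =>
      have huv : G.Adj u v := he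
      rw [key x u v huv]
      exact h u v huv

end LiftProject

end

noncomputable section

namespace LiftProject

section CompleteGraph

variable {V : Type*} [Fintype V] [DecidableEq V]

/-! ### Obstructions and walls of the complete graph -/

/-! For the complete graph the obstructions are exactly the edges, so refinement changes nothing.
The stable sets are the empty set and the singletons, and the integer hull is the simplex `x ≥ 0`,
`∑ x_i ≤ 1`. Both bounds on the rank come from one matrix form, `Y[α, β] = μ(α ∩ β)`, with `μ` a
measure on the vectors `0, e_1, ..., e_n`.

Lower bound: take `x_i = 1/(n-1)`, which lies outside the simplex. The measure with mean `x` gives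
each `e_i` the weight `1/(n-1)` and the origin the weight `-1/(n-1)`. Symmetry, consistency, the
zero entries and all linear identities hold for any signed measure on these vectors. What remains
are inequalities `∫_β f dμ ≥ 0` for slack functions `f ≥ 0`, and these hold as soon as `f(0)` is at
most the sum of `f(e_i)` over the `e_i` in `β` (`integral_outerPoint_nonneg`). An index that
contains the origin misses at most `k + 1` of the unit vectors (`IsIndex.exists_exceptions`), so for
`n ≥ 2k + 5` there are always enough of them to pay for the origin. The column lemmas, collected in
`isBaseColumn_moment`, check this for each constraint.

Upper bound: singletons are available as walls in both operators, so any face fixing at most `k`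
coordinates is an index and can be split one coordinate at a time. Two coordinates are never both
one, hence `y(T|₀) = y(F) - ∑_{i ∈ T} y(i|₁)` for `|T| ≤ k` (`IsSplitting.zeros_eq`). If `n ≤ 2k`,
cut the vertex set into `T` and its complement, both of size at most `k`; then `0 ≤ Y[Tᶜ|₀, T|₀] = 1
- ∑ x_i` (`IsSplitting.sum_ones_le`). -/

theorem rowSupport_edgeMatrix {u v : V} (h : (⊤ : SimpleGraph V).Adj u v) :
    rowSupport (edgeMatrix (⊤ : SimpleGraph V)) ⟨s(u, v), h⟩ = {u, v} := by
  ext w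
  simp only [rowSupport, edgeMatrix, Sym2.mem_iff, Finset.mem_filter, Finset.mem_univ, true_and,
    Finset.mem_insert, Finset.mem_singleton]
  split_ifs <;> simp_all

/-- A row has two coefficients equal to one and right-hand side one, so only its whole support can
violate it. The size condition then holds for every `k`. -/
theorem isObstruction_top_iff {k : ℕ} {O : Finset V} :
    IsObstruction k (edgeMatrix (⊤ : SimpleGraph V)) (edgeRhs ⊤) O ↔
      ∃ u v, u ≠ v ∧ O = {u, v} := by
  constructor
  · rintro ⟨⟨e, he⟩, hO, hsum, -⟩
    induction e with
    | h u v =>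
      have huv : u ≠ v := he
      rw [rowSupport_edgeMatrix he] at hO
      refine ⟨u, v, huv, ?_⟩
      have h1 : ∑ j ∈ O, edgeMatrix (⊤ : SimpleGraph V) ⟨s(u, v), he⟩ j ≤ (O.card : ℝ) := by
        refine (Finset.sum_le_card_nsmul O _ 1 fun j _ => ?_).trans (by simp)
        unfold edgeMatrix
        split_ifs <;> norm_num
      have h2 : 1 < O.card := by
        have : (1 : ℝ) < O.card := lt_of_lt_of_le hsum h1
        exact_mod_cast this
      exact Finset.eq_of_subset_of_card_le hO (by rw [Finset.card_pair huv]; exact h2)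
  · rintro ⟨u, v, huv, rfl⟩
    have h : (⊤ : SimpleGraph V).Adj u v := huv
    refine ⟨⟨s(u, v), h⟩, ?_, ?_, Or.inr ?_⟩
    · rw [rowSupport_edgeMatrix h]
    · rw [Finset.sum_pair huv]
      simp [edgeMatrix, edgeRhs]
    · rw [rowSupport_edgeMatrix h]
      omega

theorem refined_top (k : ℕ) :
    refined k (edgeMatrix (⊤ : SimpleGraph V)) (edgeRhs ⊤) = frac ⊤ := by
  ext x
  rw [refined, polytope_edgeMatrix]
  refine ⟨fun h => h.1, fun h => ⟨h, fun O hO => ?_⟩⟩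
  obtain ⟨u, v, huv, rfl⟩ := isObstruction_top_iff.1 hO
  rw [Finset.sum_pair huv, Finset.card_pair huv]
  have := h.2 u v huv
  push_cast
  linarith

/-- Two edges at `v` with different other ends overlap in `v` alone. This takes a third vertex and,
as two obstructions are used, `k + 1 ≥ 2`. -/
theorem isWall_singleton {k : ℕ} (hk : 1 ≤ k) (hV : 3 ≤ Fintype.card V) (v : V) :
    IsWall k (edgeMatrix (⊤ : SimpleGraph V)) (edgeRhs ⊤) {v} := by
  obtain ⟨a, ha, b, hb, hab⟩ := Finset.one_lt_card.1
    (show 1 < (Finset.univ.erase v : Finset V).card by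
      rw [Finset.card_erase_of_mem (Finset.mem_univ v), Finset.card_univ]; omega)
  have hav : a ≠ v := Finset.ne_of_mem_erase ha
  have hbv : b ≠ v := Finset.ne_of_mem_erase hb
  refine ⟨{{v, a}, {v, b}}, ?_, Finset.card_le_two.trans (by omega), ?_⟩
  · intro O hO
    rw [Finset.mem_insert, Finset.mem_singleton] at hO
    rw [isObstruction_top_iff]
    rcases hO with rfl | rfl
    · exact ⟨v, a, hav.symm, rfl⟩
    · exact ⟨v, b, hbv.symm, rfl⟩
  · have hne : ({v, a} : Finset V) ≠ {v, b} := by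
      intro h
      have : a ∈ ({v, b} : Finset V) := h ▸ (by simp)
      simp [hav, hab] at this
    ext w
    simp only [overlap, Finset.mem_filter, Finset.mem_univ, true_and, Finset.mem_singleton]
    constructor
    · rintro rfl
      exact ⟨_, by simp, _, by simp, hne, by simp, by simp⟩
    · rintro ⟨O, hO, O', hO', hOO, hw, hw'⟩
      rw [Finset.mem_insert, Finset.mem_singleton] at hO hO'
      rcases hO with rfl | rfl <;> rcases hO' with rfl | rfl
      · exact absurd rfl hOO
      · simp only [Finset.mem_insert, Finset.mem_singleton] at hw hw'
        grind
      · simp only [Finset.mem_insert, Finset.mem_singleton] at hw hw'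
        grind
      · exact absurd rfl hOO

end CompleteGraph

/-! ### Indicator functions on the cube -/

section Indicator

variable {V : Type*}

/-- The real-valued indicator of `α` at `x`. -/
def ind (α : Set (V → ℝ)) (x : V → ℝ) : ℝ := α.indicator 1 x

theorem ind_of_mem {α : Set (V → ℝ)} {x : V → ℝ} (h : x ∈ α) : ind α x = 1 := by
  simp [ind, h]

theorem ind_of_notMem {α : Set (V → ℝ)} {x : V → ℝ} (h : x ∉ α) : ind α x = 0 := by
  simp [ind, h]

theorem ind_nonneg (α : Set (V → ℝ)) (x : V → ℝ) : 0 ≤ ind α x := by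
  by_cases h : x ∈ α
  · simp [ind_of_mem h]
  · simp [ind_of_notMem h]

theorem ind_le_one (α : Set (V → ℝ)) (x : V → ℝ) : ind α x ≤ 1 := by
  by_cases h : x ∈ α
  · simp [ind_of_mem h]
  · simp [ind_of_notMem h]

theorem ind_mono {α β : Set (V → ℝ)} (h : α ⊆ β) (x : V → ℝ) : ind α x ≤ ind β x := by
  by_cases hx : x ∈ α
  · rw [ind_of_mem hx, ind_of_mem (h hx)]
  · rw [ind_of_notMem hx]
    exact ind_nonneg β x

theorem ind_inter (α β : Set (V → ℝ)) (x : V → ℝ) : ind (α ∩ β) x = ind α x * ind β x := by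
  by_cases hα : x ∈ α <;> by_cases hβ : x ∈ β
  · rw [ind_of_mem hα, ind_of_mem hβ, ind_of_mem (α := α ∩ β) ⟨hα, hβ⟩, one_mul]
  · rw [ind_of_notMem hβ, ind_of_notMem fun h => hβ h.2, mul_zero]
  · rw [ind_of_notMem hα, ind_of_notMem fun h => hα h.1, zero_mul]
  · rw [ind_of_notMem hα, ind_of_notMem fun h => hα h.1, zero_mul]

variable {x : V → ℝ} (hx : x ∈ cubeVertices V)

include hx

theorem ind_ones_singleton (i : V) : ind (ones {i}) x = x i := by
  rcases hx i with h | h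
  · rw [ind_of_notMem, h]
    rintro ⟨-, h'⟩
    rw [h' i (by simp)] at h
    norm_num at h
  · rw [ind_of_mem, h]
    exact ⟨hx, by simpa using h⟩

theorem ind_zeros_singleton (i : V) : ind (zeros {i}) x = 1 - x i := by
  rcases hx i with h | h
  · rw [ind_of_mem, h, sub_zero]
    exact ⟨hx, by simpa using h⟩
  · rw [ind_of_notMem, h, sub_self]
    rintro ⟨-, h'⟩
    rw [h' i (by simp)] at h
    norm_num at h

theorem sum_eq_card_filter (U : Finset V) [DecidablePred fun i => x i = 1] :
    ∑ i ∈ U, x i = (U.filter fun i => x i = 1).card := by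
  rw [Finset.card_filter, Nat.cast_sum]
  refine Finset.sum_congr rfl fun i _ => ?_
  rcases hx i with h | h <;> simp [h]

theorem card_filter_add_card_filter (U : Finset V) [DecidablePred fun i => x i = 1]
    [DecidablePred fun i => x i = 0] :
    (U.filter fun i => x i = 1).card + (U.filter fun i => x i = 0).card = U.card := by
  have := U.card_filter_add_card_filter_not (fun i => x i = 1)
  convert this using 3
  ext i
  rcases hx i with h | h <;> simp [h]

theorem mem_below_iff {U : Finset V} {r : ℕ} [DecidablePred fun i => x i = 1] :
    x ∈ below U r ↔ (U.filter fun i => x i = 1).card < r := by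
  have h : x ∈ below U r ↔ ∑ i ∈ U, x i ≤ (r : ℝ) - 1 := and_iff_right hx
  rw [h, sum_eq_card_filter hx, le_sub_iff_add_le]
  norm_cast

variable [DecidableEq V]

theorem mem_ones_inter_zeros_sdiff_iff {U U' : Finset V} (h : U' ⊆ U)
    [DecidablePred fun i => x i = 1] :
    x ∈ ones U' ∩ zeros (U \ U') ↔ U' = U.filter fun i => x i = 1 := by
  constructor
  · rintro ⟨⟨-, h1⟩, -, h0⟩
    ext i
    rw [Finset.mem_filter]
    refine ⟨fun hi => ⟨h hi, h1 i hi⟩, fun ⟨hi, hi1⟩ => ?_⟩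
    by_contra hc
    rw [h0 i (Finset.mem_sdiff.2 ⟨hi, hc⟩)] at hi1
    norm_num at hi1
  · rintro rfl
    refine ⟨⟨hx, fun i hi => (Finset.mem_filter.1 hi).2⟩, hx, fun i hi => ?_⟩
    rw [Finset.mem_sdiff, Finset.mem_filter] at hi
    exact (hx i).resolve_right fun h1 => hi.2 ⟨hi.1, h1⟩

theorem ind_split (S T : Finset V) {i : V} (hi : i ∈ T) :
    ind (ones S ∩ zeros T) x + ind (ones (insert i S) ∩ zeros (T.erase i)) x =
      ind (ones S ∩ zeros (T.erase i)) x := by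
  have hz : (x ∈ zeros T) ↔ x i = 0 ∧ x ∈ zeros (T.erase i) := by
    simp only [zeros, Set.mem_ofPred_eq, hx, true_and, Finset.mem_erase]
    refine ⟨fun h => ⟨h i hi, fun j hj => h j hj.2⟩, fun h j hj => ?_⟩
    by_cases hji : j = i
    · exact hji ▸ h.1
    · exact h.2 j ⟨hji, hj⟩
  have ho : (x ∈ ones (insert i S)) ↔ x i = 1 ∧ x ∈ ones S := by
    simp [ones, hx]
  by_cases hb : x ∈ ones S ∩ zeros (T.erase i)
  · rcases hx i with h | h
    · rw [ind_of_mem hb, ind_of_mem (α := ones S ∩ zeros T) ⟨hb.1, hz.2 ⟨h, hb.2⟩⟩, ind_of_notMem,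
        add_zero]
      rintro ⟨h1, -⟩
      rw [(ho.1 h1).1] at h
      norm_num at h
    · rw [ind_of_mem hb, ind_of_mem (α := ones (insert i S) ∩ zeros (T.erase i))
        ⟨ho.2 ⟨h, hb.1⟩, hb.2⟩, ind_of_notMem, zero_add]
      rintro ⟨-, h1⟩
      rw [(hz.1 h1).1] at h
      norm_num at h
  · rw [ind_of_notMem hb, ind_of_notMem, ind_of_notMem, add_zero]
    · exact fun h => hb ⟨(ho.1 h.1).2, h.2⟩
    · exact fun h => hb ⟨h.1, (hz.1 h.2).2⟩

/-- A sum over a family of subsets of `U` of indicators of the faces that fix all of `U`. -/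
theorem sum_ind_faces (α : Set (V → ℝ)) (U : Finset V) (p : Finset V → Prop) [DecidablePred p]
    [DecidablePred fun i => x i = 1] :
    ∑ U' ∈ U.powerset.filter p, ind (α ∩ (ones U' ∩ zeros (U \ U'))) x =
      if p (U.filter fun i => x i = 1) then ind α x else 0 := by
  -- A cube vertex lies on exactly one face fixing all of `U`, the one whose `U'` is its set of ones
  -- in `U`; the sum has at most this one term.
  have h1 : ∀ U' ∈ U.powerset.filter p, ind (α ∩ (ones U' ∩ zeros (U \ U'))) x =
      if U' = U.filter (fun i => x i = 1) then ind α x else 0 := by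
    intro U' hU'
    rw [Finset.mem_filter, Finset.mem_powerset] at hU'
    have := mem_ones_inter_zeros_sdiff_iff hx hU'.1
    rw [ind_inter]
    split_ifs with h
    · rw [ind_of_mem (this.2 h), mul_one]
    · rw [ind_of_notMem fun h' => h (this.1 h'), mul_zero]
  rw [Finset.sum_congr rfl h1, Finset.sum_ite_eq']
  simp

theorem ind_below_eq (S T U : Finset V) (r : ℕ) :
    ind (ones S ∩ zeros T ∩ below U r) x = ind (ones S ∩ zeros T) x -
      ∑ U' ∈ U.powerset.filter (fun U' => r ≤ U'.card),
        ind (ones (S ∪ U') ∩ zeros (T ∪ (U \ U'))) x := by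
  classical
  have h : ∀ U' : Finset V, ones (S ∪ U') ∩ zeros (T ∪ (U \ U')) =
      ones S ∩ zeros T ∩ (ones U' ∩ zeros (U \ U')) := by
    intro U'
    ext z
    simp only [ones, zeros, Set.mem_inter_iff, Set.mem_ofPred_eq, Finset.mem_union]
    grind
  simp_rw [h]
  rw [sum_ind_faces hx, ind_inter]
  have := mem_below_iff hx (U := U) (r := r)
  split_ifs with hr
  · rw [ind_of_notMem (α := below U r) fun h => by have := this.1 h; omega, mul_zero, sub_self]
  · rw [ind_of_mem (this.2 (by omega)), mul_one, sub_zero]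

theorem sum_ind_faces_compl (α : Set (V → ℝ)) (U : Finset V) (p : ℕ → Prop) [DecidablePred p]
    [DecidablePred fun i => x i = 0] :
    ∑ U' ∈ U.powerset.filter (fun U' => p U'.card), ind (α ∩ (ones (U \ U') ∩ zeros U')) x =
      if p (U.filter fun i => x i = 0).card then ind α x else 0 := by
  classical
  have h0 : U \ U.filter (fun i => x i = 1) = U.filter fun i => x i = 0 := by
    ext i
    rcases hx i with h | h <;> simp [h]
  have := sum_ind_faces hx α U (fun U' => p (U \ U').card)
  rw [h0] at this
  rw [← this]
  refine Finset.sum_nbij' (fun U' => U \ U') (fun U' => U \ U') ?_ ?_ ?_ ?_ ?_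
  · intro U' hU'
    rw [Finset.mem_filter, Finset.mem_powerset] at hU' ⊢
    rw [Finset.sdiff_sdiff_eq_self hU'.1]
    exact ⟨Finset.sdiff_subset, hU'.2⟩
  · intro U' hU'
    rw [Finset.mem_filter, Finset.mem_powerset] at hU' ⊢
    exact ⟨Finset.sdiff_subset, hU'.2⟩
  · intro U' hU'
    rw [Finset.mem_filter, Finset.mem_powerset] at hU'
    exact Finset.sdiff_sdiff_eq_self hU'.1
  · intro U' hU'
    rw [Finset.mem_filter, Finset.mem_powerset] at hU'
    exact Finset.sdiff_sdiff_eq_self hU'.1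
  · intro U' hU'
    rw [Finset.mem_filter, Finset.mem_powerset] at hU'
    rw [Finset.sdiff_sdiff_eq_self hU'.1]

theorem sum_ind_powerset (α : Set (V → ℝ)) (U : Finset V) :
    ∑ U' ∈ U.powerset, ind (α ∩ (ones (U \ U') ∩ zeros U')) x = ind α x := by
  classical
  simpa using sum_ind_faces_compl hx α U (fun _ => True)

theorem sum_ind_add_below (α : Set (V → ℝ)) (U : Finset V) {r : ℕ} (hr : r < U.card) :
    ∑ U' ∈ U.powerset.filter (fun U' => U'.card ≤ r), ind (α ∩ (ones (U \ U') ∩ zeros U')) x +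
      ind (α ∩ below U (U.card - r)) x = ind α x := by
  classical
  rw [sum_ind_faces_compl hx α U (fun m => m ≤ r), ind_inter]
  have h1 := mem_below_iff hx (U := U) (r := U.card - r)
  have h2 := card_filter_add_card_filter hx U
  split_ifs with h
  · rw [ind_of_notMem (α := below U (U.card - r)) fun h' => by have := h1.1 h'; omega,
      mul_zero, add_zero]
  · rw [ind_of_mem (h1.2 (by omega)), mul_one, zero_add]

end Indicator

/-! ### Moments of signed measures on the stable sets of the complete graph -/

section Moment

variable {V : Type*} [DecidableEq V]

/-- The incidence vectors of the stable sets of the complete graph. -/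
def atom : Option V → V → ℝ
  | none => 0
  | some i => Pi.single i 1

theorem atom_mem_cubeVertices (o : Option V) : atom o ∈ cubeVertices V := by
  intro i
  cases o with
  | none => exact Or.inl rfl
  | some j =>
    by_cases h : i = j
    · subst h; simp [atom]
    · simp [atom, h]

theorem atom_none_apply (i : V) : atom none i = 0 := rfl

theorem atom_some_apply (i j : V) : atom (some i) j = if j = i then 1 else 0 := by
  simp [atom, Pi.single_apply]

theorem atom_nonneg (o : Option V) (i : V) : 0 ≤ atom o i := by
  rcases atom_mem_cubeVertices o i with h | h <;> simp [h]

theorem atom_le_one (o : Option V) (i : V) : atom o i ≤ 1 := by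
  rcases atom_mem_cubeVertices o i with h | h <;> simp [h]

theorem atom_add_le_one (o : Option V) {i j : V} (h : i ≠ j) : atom o i + atom o j ≤ 1 := by
  cases o with
  | none => simp [atom]
  | some l =>
    rw [atom_some_apply, atom_some_apply]
    split_ifs with h1 h2
    · exact absurd (h1.trans h2.symm) h
    all_goals norm_num

theorem atom_mem_frac (o : Option V) : atom o ∈ frac (⊤ : SimpleGraph V) :=
  ⟨fun i => ⟨atom_nonneg o i, atom_le_one o i⟩, fun _ _ h => atom_add_le_one o h⟩

theorem sum_atom_none (U : Finset V) : ∑ i ∈ U, atom none i = 0 := by simp [atom]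

theorem sum_atom_some (U : Finset V) (j : V) :
    ∑ i ∈ U, atom (some j) i = if j ∈ U then 1 else 0 := by
  simp [atom_some_apply]

variable [Fintype V]

/-- The weights on the atoms that have total one and mean `x`. -/
def weight (x : V → ℝ) : Option V → ℝ
  | none => 1 - ∑ i, x i
  | some i => x i

/-- The measure of `α` under the signed measure on the atoms with mean `x`. -/
def moment (x : V → ℝ) (α : Set (V → ℝ)) : ℝ := ∑ o, weight x o * ind α (atom o)

/-- The integral over `β` under the signed measure on the atoms with mean `x`. -/
def integral (x : V → ℝ) (β : Set (V → ℝ)) (f : Option V → ℝ) : ℝ :=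
  ∑ o, weight x o * ind β (atom o) * f o

variable {x : V → ℝ} {α β : Set (V → ℝ)}

theorem moment_inter (x : V → ℝ) (α β : Set (V → ℝ)) :
    moment x (α ∩ β) = integral x β fun o => ind α (atom o) := by
  refine Finset.sum_congr rfl fun o _ => ?_
  rw [ind_inter]
  ring

theorem integral_add (f g : Option V → ℝ) :
    integral x β (fun o => f o + g o) = integral x β f + integral x β g := by
  simp [integral, mul_add, Finset.sum_add_distrib]

theorem integral_sub (f g : Option V → ℝ) :
    integral x β (fun o => f o - g o) = integral x β f - integral x β g := by
  simp [integral, mul_sub, Finset.sum_sub_distrib]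

theorem integral_const_mul (c : ℝ) (f : Option V → ℝ) :
    integral x β (fun o => c * f o) = c * integral x β f := by
  rw [integral, integral, Finset.mul_sum]
  exact Finset.sum_congr rfl fun o _ => by ring

theorem integral_sum {κ : Type*} (s : Finset κ) (f : κ → Option V → ℝ) :
    integral x β (fun o => ∑ j ∈ s, f j o) = ∑ j ∈ s, integral x β (f j) := by
  simp only [integral, Finset.mul_sum]
  exact Finset.sum_comm

theorem integral_congr {f g : Option V → ℝ} (h : ∀ o, f o = g o) :
    integral x β f = integral x β g := by
  rw [funext h]

theorem moment_cubeVertices : moment x (cubeVertices V) = 1 := by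
  have h : ∀ o : Option V, ind (cubeVertices V) (atom o) = 1 := fun o =>
    ind_of_mem (atom_mem_cubeVertices o)
  simp [moment, h, Fintype.sum_option, weight]

theorem moment_ones_singleton (i : V) : moment x (ones {i}) = x i := by
  have h : ∀ o : Option V, ind (ones {i}) (atom o) = atom o i := fun o =>
    ind_ones_singleton (atom_mem_cubeVertices o) i
  simp [moment, h, Fintype.sum_option, weight, atom_none_apply, atom_some_apply]

/-- Responsible for the prescribed zero entries of both operators: their intersections contain no
stable set. -/
theorem moment_eq_zero (h : ∀ o, atom o ∉ α) : moment x α = 0 :=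
  Finset.sum_eq_zero fun o _ => by rw [ind_of_notMem (h o), mul_zero]

theorem hat_moment :
    hat (fun α => moment x (α ∩ cubeVertices V)) = (1, x) := by
  have h : ∀ i : V, ones {i} ∩ cubeVertices V = ones {i} := fun i =>
    Set.inter_eq_left.2 fun _ h => h.1
  simp only [hat, Set.inter_self, h, moment_cubeVertices, moment_ones_singleton]

/-- Over `β`, the value of `f` at the origin is outweighed by its values at the unit vectors. -/
def Dominated (β : Set (V → ℝ)) (f : Option V → ℝ) : Prop :=
  (0 : V → ℝ) ∈ β → f none ≤ ∑ i, ind β (atom (some i)) * f (some i)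

/-! ### Criteria for domination -/

theorem dominated_of_nonpos {f : Option V → ℝ} (hf : ∀ o, 0 ≤ f o) (h : f none ≤ 0) :
    Dominated β f := fun _ =>
  h.trans (Finset.sum_nonneg fun _ _ => mul_nonneg (ind_nonneg _ _) (hf _))

theorem dominated_of_one {f : Option V → ℝ} (hf : ∀ o, 0 ≤ f o)
    (h : (0 : V → ℝ) ∈ β → ∃ i, atom (some i) ∈ β ∧ f none ≤ f (some i)) :
    Dominated β f := by
  intro hβ
  obtain ⟨i, hi, hfi⟩ := h hβ
  refine hfi.trans ?_
  have := Finset.single_le_sum (f := fun i => ind β (atom (some i)) * f (some i))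
    (fun _ _ => mul_nonneg (ind_nonneg _ _) (hf _)) (Finset.mem_univ i)
  simpa only [ind_of_mem hi, one_mul] using this

theorem dominated_of_two {f : Option V → ℝ} (hf : ∀ o, 0 ≤ f o)
    (h : (0 : V → ℝ) ∈ β → ∃ i j, i ≠ j ∧ atom (some i) ∈ β ∧ atom (some j) ∈ β ∧
      f none ≤ f (some i) + f (some j)) :
    Dominated β f := by
  intro hβ
  obtain ⟨i, j, hij, hi, hj, hfi⟩ := h hβ
  refine hfi.trans ?_
  have := Finset.sum_le_sum_of_subset_of_nonneg
    (f := fun i => ind β (atom (some i)) * f (some i)) (Finset.subset_univ {i, j})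
    (fun _ _ _ => mul_nonneg (ind_nonneg _ _) (hf _))
  simpa only [Finset.sum_pair hij, ind_of_mem hi, ind_of_mem hj, one_mul] using this

theorem integral_nonneg_of_mem_simplex (hx : ∀ i, 0 ≤ x i) (hs : ∑ i, x i ≤ 1)
    {f : Option V → ℝ} (hf : ∀ o, 0 ≤ f o) : 0 ≤ integral x β f := by
  refine Finset.sum_nonneg fun o _ => mul_nonneg (mul_nonneg ?_ (ind_nonneg _ _)) (hf o)
  cases o with
  | none => exact sub_nonneg.2 hs
  | some i => exact hx i

/-- The point just outside the integer hull. -/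
def outerPoint (V : Type*) [Fintype V] : V → ℝ := fun _ => ((Fintype.card V : ℝ) - 1)⁻¹

/-- The unit vectors carry total weight `n/(n-1)`, leaving `-1/(n-1)` for the origin. All weights
have the same size, so the sign of the integral is that of the difference in `Dominated`. -/
theorem integral_outerPoint_nonneg (hV : 2 ≤ Fintype.card V) {f : Option V → ℝ}
    (hf : ∀ o, 0 ≤ f o) (hd : Dominated β f) : 0 ≤ integral (outerPoint V) β f := by
  have h2 : (2 : ℝ) ≤ Fintype.card V := by exact_mod_cast hV
  have hpos : 0 < ((Fintype.card V : ℝ) - 1)⁻¹ := inv_pos.2 (by linarith)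
  have hw : 1 - ∑ i, outerPoint V i = -((Fintype.card V : ℝ) - 1)⁻¹ := by
    simp only [outerPoint, Finset.sum_const, Finset.card_univ, nsmul_eq_mul]
    field_simp [show (Fintype.card V : ℝ) - 1 ≠ 0 by linarith]
    ring
  have hi : integral (outerPoint V) β f = ((Fintype.card V : ℝ) - 1)⁻¹ *
      (∑ i, ind β (atom (some i)) * f (some i) - ind β 0 * f none) := by
    rw [integral, Fintype.sum_option, weight, hw, mul_sub, Finset.mul_sum]
    simp only [weight, outerPoint, atom, mul_assoc]
    ring
  rw [hi]
  refine mul_nonneg hpos.le (sub_nonneg.2 ?_)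
  by_cases h0 : (0 : V → ℝ) ∈ β
  · rw [ind_of_mem h0, one_mul]
    exact hd h0
  · rw [ind_of_notMem h0, zero_mul]
    exact Finset.sum_nonneg fun _ _ => mul_nonneg (ind_nonneg _ _) (hf _)

end Moment

/-! ### The shape of the variables -/

section Shape

variable {V : Type*}

theorem below_empty_one : below (∅ : Finset V) 1 = cubeVertices V := by
  ext x
  simp [below]

theorem ones_empty : ones (∅ : Finset V) = cubeVertices V := by
  ext x
  simp [ones]

theorem zeros_empty : zeros (∅ : Finset V) = cubeVertices V := by
  ext x
  simp [zeros]

theorem ones_inter_zeros_inter_cubeVertices (S T : Finset V) :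
    ones S ∩ zeros T ∩ cubeVertices V = ones S ∩ zeros T :=
  Set.inter_eq_left.2 fun _ h => h.1.1

theorem zero_mem_cubeVertices : (0 : V → ℝ) ∈ cubeVertices V := fun _ => Or.inl rfl

theorem zero_mem_zeros (T : Finset V) : (0 : V → ℝ) ∈ zeros T :=
  ⟨zero_mem_cubeVertices, fun _ _ => rfl⟩

theorem zero_mem_below (U : Finset V) {r : ℕ} : (0 : V → ℝ) ∈ below U r ↔ 1 ≤ r := by
  simp only [below, Set.mem_ofPred_eq, zero_mem_cubeVertices, true_and, Pi.zero_apply,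
    Finset.sum_const_zero, sub_nonneg]
  norm_cast

theorem zero_mem_ones {S : Finset V} : (0 : V → ℝ) ∈ ones S ↔ S = ∅ := by
  simp [ones, zero_mem_cubeVertices, Finset.eq_empty_iff_forall_notMem]

/-- The common shape of the variables of both operators at level `k`. -/
def IsIndex (k : ℕ) (α : Set (V → ℝ)) : Prop :=
  ∃ (S T U : Finset V) (r : ℕ), 1 ≤ r ∧ T.card ≤ k + 1 ∧ T.card + U.card ≤ k + r ∧
    α = ones S ∩ zeros T ∩ below U r

theorem isIndex_ones_inter_zeros {k : ℕ} (S : Finset V) {T : Finset V} (hT : T.card ≤ k + 1) :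
    IsIndex k (ones S ∩ zeros T) :=
  ⟨S, T, ∅, 1, le_rfl, hT, by simpa using hT, by
    rw [below_empty_one, ones_inter_zeros_inter_cubeVertices]⟩

theorem isIndex_cubeVertices (k : ℕ) : IsIndex k (cubeVertices V) := by
  have := isIndex_ones_inter_zeros (k := k) (∅ : Finset V) (T := ∅) (by simp)
  rwa [ones_empty, zeros_empty, Set.inter_self] at this

theorem isIndex_ones (k : ℕ) (S : Finset V) : IsIndex k (ones S) := by
  have := isIndex_ones_inter_zeros (k := k) S (T := ∅) (by simp)
  rwa [zeros_empty, Set.inter_eq_left.2 fun _ h => h.1] at this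

theorem isIndex_zeros {k : ℕ} {T : Finset V} (hT : T.card ≤ k + 1) : IsIndex k (zeros T) := by
  have := isIndex_ones_inter_zeros (k := k) ∅ hT
  rwa [ones_empty, Set.inter_eq_right.2 fun _ h => h.1] at this

theorem IsIndex.subset_ones {k : ℕ} {α : Set (V → ℝ)} (h : IsIndex k α)
    (h0 : (0 : V → ℝ) ∉ α) : ∃ i, α ⊆ ones {i} := by
  obtain ⟨S, T, U, r, hr, -, -, rfl⟩ := h
  have hS : S ≠ ∅ := fun hS => h0 ⟨⟨zero_mem_ones.2 hS, zero_mem_zeros T⟩, (zero_mem_below U).2 hr⟩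
  obtain ⟨i, hi⟩ := Finset.nonempty_iff_ne_empty.2 hS
  refine ⟨i, fun x hx => ⟨hx.1.1.1, fun j hj => ?_⟩⟩
  rw [Finset.mem_singleton] at hj
  exact hx.1.1.2 j (hj ▸ hi)

variable [DecidableEq V]

theorem atom_some_mem_zeros {T : Finset V} {i : V} : atom (some i) ∈ zeros T ↔ i ∉ T := by
  simp only [zeros, Set.mem_ofPred_eq, atom_mem_cubeVertices, true_and, atom_some_apply]
  grind

theorem atom_some_mem_below {U : Finset V} {i : V} {r : ℕ} :
    atom (some i) ∈ below U r ↔ (if i ∈ U then 2 else 1) ≤ r := by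
  simp only [below, Set.mem_ofPred_eq, atom_mem_cubeVertices, true_and, sum_atom_some]
  split_ifs
  · rw [le_sub_iff_add_le]; norm_num
  · simp

/-! ### Unit vectors contained in an index -/

namespace IsIndex

variable {k : ℕ} {α : Set (V → ℝ)}

/-- As the index contains the origin, no coordinate is forced to one. For `r = 1` the unit vectors
of `T ∪ U` are lost, and `|T| + |U| ≤ k + 1`; for `r ≥ 2` a single one in `U` is harmless and only
`T` is lost. -/
theorem exists_exceptions (h : IsIndex k α) (h0 : (0 : V → ℝ) ∈ α) :
    ∃ R : Finset V, R.card ≤ k + 1 ∧ ∀ i ∉ R, atom (some i) ∈ α := by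
  obtain ⟨S, T, U, r, hr, hT, hTU, rfl⟩ := h
  have hS : S = ∅ := zero_mem_ones.1 h0.1.1
  subst hS
  by_cases hr1 : r = 1
  · refine ⟨T ∪ U, (Finset.card_union_le T U).trans (by omega), fun i hi => ?_⟩
    rw [Finset.mem_union, not_or] at hi
    refine ⟨⟨ones_empty ▸ atom_mem_cubeVertices _, atom_some_mem_zeros.2 hi.1⟩, ?_⟩
    rw [atom_some_mem_below, if_neg hi.2]
    exact hr
  · refine ⟨T, hT, fun i hi => ?_⟩
    refine ⟨⟨ones_empty ▸ atom_mem_cubeVertices _, atom_some_mem_zeros.2 hi⟩, ?_⟩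
    rw [atom_some_mem_below]
    split_ifs <;> omega

/-- The sums `e_i + e_j` carry no mass. They serve as test points in `IsIndex.card_le_of_below_two`.
-/
theorem exists_pair_exceptions (h : IsIndex k α) (h0 : (0 : V → ℝ) ∈ α) :
    ∃ R : Finset V, R.card ≤ k + 2 ∧ ∀ i ∉ R, ∀ j ∉ R, i ≠ j →
      (Pi.single i 1 + Pi.single j 1 : V → ℝ) ∈ α := by
  obtain ⟨S, T, U, r, hr, hT, hTU, rfl⟩ := h
  have hS : S = ∅ := zero_mem_ones.1 h0.1.1
  subst hS
  have hc : ∀ i j : V, i ≠ j → (Pi.single i 1 + Pi.single j 1 : V → ℝ) ∈ cubeVertices V := by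
    intro i j hij l
    simp only [Pi.add_apply, Pi.single_apply]
    grind
  have hz : ∀ i j : V, i ≠ j → i ∉ T → j ∉ T →
      (Pi.single i 1 + Pi.single j 1 : V → ℝ) ∈ zeros T := by
    intro i j hij hi hj
    refine ⟨hc i j hij, fun l hl => ?_⟩
    simp only [Pi.add_apply, Pi.single_apply]
    grind
  have hs : ∀ i j : V, ∑ l ∈ U, (Pi.single i 1 + Pi.single j 1 : V → ℝ) l =
      (if i ∈ U then 1 else 0) + (if j ∈ U then 1 else 0) := by
    intro i j
    simp [Finset.sum_add_distrib, Pi.single_apply]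
  by_cases hr2 : r ≤ 2
  · refine ⟨T ∪ U, (Finset.card_union_le T U).trans (by omega), fun i hi j hj hij => ?_⟩
    rw [Finset.mem_union, not_or] at hi hj
    refine ⟨⟨ones_empty ▸ hc i j hij, hz i j hij hi.1 hj.1⟩, hc i j hij, ?_⟩
    rw [hs, if_neg hi.2, if_neg hj.2, add_zero, sub_nonneg]
    exact_mod_cast hr
  · refine ⟨T, by omega, fun i hi j hj hij => ?_⟩
    refine ⟨⟨ones_empty ▸ hc i j hij, hz i j hij hi hj⟩, hc i j hij, ?_⟩
    have : (3 : ℝ) ≤ r := by exact_mod_cast (by omega : 3 ≤ r)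
    rw [hs]
    split_ifs <;> linarith

variable [Fintype V] {β : Set (V → ℝ)}

theorem exists_atom (hβ : IsIndex k β) (h0 : (0 : V → ℝ) ∈ β) (R : Finset V)
    (hR : R.card + (k + 1) < Fintype.card V) : ∃ i ∉ R, atom (some i) ∈ β := by
  obtain ⟨R', hR', h⟩ := hβ.exists_exceptions h0
  obtain ⟨i, hi⟩ : ∃ i, i ∉ R ∪ R' := by
    by_contra! hc
    have := Finset.card_union_le R R'
    rw [Finset.eq_univ_iff_forall.2 hc, Finset.card_univ] at this
    omega
  rw [Finset.mem_union, not_or] at hi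
  exact ⟨i, hi.1, h i hi.2⟩

theorem exists_atom_inter (hβ : IsIndex k β) (h0 : (0 : V → ℝ) ∈ β) (hα : IsIndex k α)
    (h0' : (0 : V → ℝ) ∈ α) (R : Finset V)
    (hR : R.card + (k + 1) + (k + 1) < Fintype.card V) :
    ∃ i ∉ R, atom (some i) ∈ β ∧ atom (some i) ∈ α := by
  obtain ⟨R', hR', h⟩ := hα.exists_exceptions h0'
  have := Finset.card_union_le R R'
  obtain ⟨i, hi, hiβ⟩ := hβ.exists_atom h0 (R ∪ R') (by omega)
  rw [Finset.mem_union, not_or] at hi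
  exact ⟨i, hi.1, hiβ, h i hi.2⟩

end IsIndex

end Shape

/-! ### The constraints on the columns of a moment matrix -/

section Columns

variable {V : Type*} [Fintype V] [DecidableEq V]

theorem mem_cone_frac_top {V : Type*} {c : ℝ} {v : V → ℝ} (hc : 0 ≤ c) (hv : ∀ i, 0 ≤ v i)
    (h1 : ∀ i, v i ≤ c) (h2 : ∀ i j, i ≠ j → v i + v j ≤ c) :
    (c, v) ∈ cone (frac (⊤ : SimpleGraph V)) := by
  rcases hc.eq_or_lt with rfl | hc
  · refine ⟨0, le_rfl, 0, ⟨fun _ => by simp, fun _ _ _ => by simp⟩, ?_⟩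
    rw [zero_smul]
    exact Prod.ext rfl (funext fun i => le_antisymm (h1 i) (hv i))
  · refine ⟨c, hc.le, c⁻¹ • v, ⟨fun i => ⟨?_, ?_⟩, fun i j hij => ?_⟩, ?_⟩
    · exact mul_nonneg (inv_nonneg.2 hc.le) (hv i)
    · rw [Pi.smul_apply, smul_eq_mul, inv_mul_le_iff₀ hc, mul_one]
      exact h1 i
    · rw [Pi.smul_apply, Pi.smul_apply, smul_eq_mul, smul_eq_mul, ← mul_add,
        inv_mul_le_iff₀ hc, mul_one]
      exact h2 i j hij
    · rw [smul_inv_smul₀ hc.ne']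

/-- Integration over `β` is nonnegative on the nonnegative functions which, if there are at least
`2 k + 5` indices, are in addition dominated over `β`. -/
def IsPositive (k : ℕ) (x : V → ℝ) (β : Set (V → ℝ)) : Prop :=
  ∀ f : Option V → ℝ, (∀ o, 0 ≤ f o) → (2 * k + 5 ≤ Fintype.card V → Dominated β f) →
    0 ≤ integral x β f

/-- Inside the simplex the measure is nonnegative and domination is irrelevant. Through `IsPositive`
the column lemmas cover both these points, for every `k`, and the outer point. -/
theorem isPositive_of_mem_simplex {x : V → ℝ} (hx : ∀ i, 0 ≤ x i) (hs : ∑ i, x i ≤ 1) (k : ℕ)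
    (β : Set (V → ℝ)) : IsPositive k x β :=
  fun _ hf _ => integral_nonneg_of_mem_simplex hx hs hf

theorem isPositive_outerPoint {k : ℕ} (hV : 2 * k + 5 ≤ Fintype.card V) (β : Set (V → ℝ)) :
    IsPositive k (outerPoint V) β :=
  fun _ hf hd => integral_outerPoint_nonneg (by omega) hf (hd hV)

variable {k : ℕ} {x : V → ℝ} {α β : Set (V → ℝ)}

theorem moment_inter_cubeVertices (x : V → ℝ) (β : Set (V → ℝ)) :
    moment x (cubeVertices V ∩ β) = integral x β fun _ => 1 := by
  rw [moment_inter]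
  exact integral_congr fun o => ind_of_mem (atom_mem_cubeVertices o)

theorem moment_inter_ones (x : V → ℝ) (β : Set (V → ℝ)) (i : V) :
    moment x (ones {i} ∩ β) = integral x β fun o => atom o i := by
  rw [moment_inter]
  exact integral_congr fun o => ind_ones_singleton (atom_mem_cubeVertices o) i

theorem moment_inter_zeros (x : V → ℝ) (β : Set (V → ℝ)) (i : V) :
    moment x (zeros {i} ∩ β) = integral x β fun o => 1 - atom o i := by
  rw [moment_inter]
  exact integral_congr fun o => ind_zeros_singleton (atom_mem_cubeVertices o) i

/-- An index outside `R` whose unit vector lies in `β`. -/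
theorem IsIndex.exists_atom_of_card_le (hβ : IsIndex k β) (hV : 2 * k + 5 ≤ Fintype.card V)
    (h0 : (0 : V → ℝ) ∈ β) (R : Finset V) (hR : R.card ≤ k + 3) :
    ∃ i ∉ R, atom (some i) ∈ β :=
  hβ.exists_atom h0 R (by omega)

theorem ind_eq_zero_of_subset_ones {V : Type*} [DecidableEq V] {α : Set (V → ℝ)} {i j : V}
    (h : α ⊆ ones {j}) (hij : i ≠ j) :
    ind α (atom (some i)) = 0 := by
  refine ind_of_notMem fun hi => ?_
  have := (h hi).2 j (Finset.mem_singleton_self j)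
  rw [atom_some_apply, if_neg hij.symm] at this
  norm_num at this

theorem moment_inter_nonneg (hβ : IsIndex k β) (hpos : IsPositive k x β) (hα : IsIndex k α) :
    0 ≤ moment x (α ∩ β) := by
  rw [moment_inter]
  have hf : ∀ o : Option V, 0 ≤ ind α (atom o) := fun o => ind_nonneg _ _
  refine hpos _ hf fun hV => ?_
  by_cases h0 : (0 : V → ℝ) ∈ α
  · refine dominated_of_one hf fun h0β => ?_
    obtain ⟨i, -, hiβ, hiα⟩ := hβ.exists_atom_inter h0β hα h0 ∅ (by simp; omega)
    exact ⟨i, hiβ, by rw [ind_of_mem hiα]; exact ind_le_one _ _⟩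
  · exact dominated_of_nonpos hf (ind_of_notMem h0).le

/-- The slack is the indicator of `γ \ α`. The set `R` collects the unit vectors that `γ` may miss:
none for the cube, one for `zeros {i}`. -/
theorem moment_inter_mono {γ : Set (V → ℝ)} (hβ : IsIndex k β) (hpos : IsPositive k x β)
    (hα : IsIndex k α) (hαγ : α ⊆ γ) {R : Finset V} (hR : R.card ≤ 1)
    (hγ : (0 : V → ℝ) ∈ γ → ∀ i ∉ R, atom (some i) ∈ γ) :
    moment x (α ∩ β) ≤ moment x (γ ∩ β) := by
  rw [moment_inter, moment_inter, ← sub_nonneg, ← integral_sub]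
  have hf : ∀ o : Option V, 0 ≤ ind γ (atom o) - ind α (atom o) :=
    fun o => sub_nonneg.2 (ind_mono hαγ _)
  refine hpos _ hf fun hV => ?_
  by_cases h0γ : (0 : V → ℝ) ∈ γ
  · by_cases h0 : (0 : V → ℝ) ∈ α
    · refine dominated_of_nonpos hf ?_
      rw [show atom none = (0 : V → ℝ) from rfl, ind_of_mem h0, ind_of_mem h0γ, sub_self]
    -- Here the origin lies in `γ \ α`, so `α` forces some coordinate `j` to one. Any unit vector of
    -- `β` other than `e_j` and outside `R` also lies in `γ \ α`.
    · refine dominated_of_one hf fun h0β => ?_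
      obtain ⟨j, hj⟩ := hα.subset_ones h0
      obtain ⟨i, hiR, hiβ⟩ := hβ.exists_atom_of_card_le hV h0β (insert j R)
        ((Finset.card_insert_le _ _).trans (by omega))
      rw [Finset.mem_insert, not_or] at hiR
      refine ⟨i, hiβ, ?_⟩
      rw [ind_eq_zero_of_subset_ones hj hiR.1, ind_of_mem (hγ h0γ i hiR.2), sub_zero]
      exact (sub_le_self _ (ind_nonneg _ _)).trans (ind_le_one _ _)
  · refine dominated_of_nonpos hf ?_
    rw [show atom none = (0 : V → ℝ) from rfl, ind_of_notMem h0γ,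
      ind_of_notMem fun h => h0γ (hαγ h), sub_self]

theorem hat_moment_inter_mem (hβ : IsIndex k β) (hpos : IsPositive k x β) :
    hat (fun α => moment x (α ∩ β)) ∈ cone (frac (⊤ : SimpleGraph V)) := by
  refine mem_cone_frac_top (moment_inter_nonneg hβ hpos (isIndex_cubeVertices k))
    (fun i => moment_inter_nonneg hβ hpos (isIndex_ones k {i})) (fun i => ?_) fun i j hij => ?_
  · exact moment_inter_mono hβ hpos (isIndex_ones k {i}) (fun _ h => h.1) (R := ∅) (by simp)
      fun _ _ _ => atom_mem_cubeVertices _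
  · beta_reduce
    rw [moment_inter_ones, moment_inter_ones, moment_inter_cubeVertices, ← sub_nonneg,
      ← integral_add, ← integral_sub]
    have hf : ∀ o : Option V, 0 ≤ 1 - (atom o i + atom o j) :=
      fun o => sub_nonneg.2 (atom_add_le_one o hij)
    -- The edge slack is one at the origin and at every unit vector off the edge.
    refine hpos _ hf fun hV => dominated_of_one hf fun h0 => ?_
    obtain ⟨l, hl, hlβ⟩ := hβ.exists_atom_of_card_le hV h0 {i, j}
      (Finset.card_le_two.trans (by omega))
    refine ⟨l, hlβ, ?_⟩
    simp only [Finset.mem_insert, Finset.mem_singleton, not_or] at hl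
    rw [atom_some_apply, atom_some_apply, if_neg fun h => hl.1 h.symm, if_neg fun h => hl.2 h.symm]
    simp [atom_none_apply]

theorem IsIndex.exists_two_atoms (hβ : IsIndex k β) (hV : 2 * k + 5 ≤ Fintype.card V)
    (h0 : (0 : V → ℝ) ∈ β) (R : Finset V) (hR : R.card ≤ 1) :
    ∃ i j, i ≠ j ∧ i ∉ R ∧ j ∉ R ∧ atom (some i) ∈ β ∧ atom (some j) ∈ β := by
  obtain ⟨i, hi, hiβ⟩ := hβ.exists_atom_of_card_le hV h0 R (by omega)
  obtain ⟨j, hj, hjβ⟩ := hβ.exists_atom_of_card_le hV h0 (insert i R)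
    ((Finset.card_insert_le _ _).trans (by omega))
  rw [Finset.mem_insert, not_or] at hj
  exact ⟨i, j, fun h => hj.1 h.symm, hi, hj.2, hiβ, hjβ⟩

theorem union_bound_pointwise {z : V → ℝ} (hz : z ∈ cubeVertices V) (S T : Finset V) :
    ∑ i ∈ S, z i + ∑ i ∈ T, (1 - z i) - ind (ones S ∩ zeros T) z ≤
      (S.card : ℝ) + (T.card : ℝ) - 1 := by
  have h0 : ∀ i, 0 ≤ z i := fun i => by rcases hz i with h | h <;> simp [h]
  have h1 : ∀ i, z i ≤ 1 := fun i => by rcases hz i with h | h <;> simp [h]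
  have hS : ∑ i ∈ S, z i ≤ S.card := by
    simpa using Finset.sum_le_card_nsmul S z 1 fun i _ => h1 i
  have hT : ∑ i ∈ T, (1 - z i) ≤ T.card := by
    simpa using Finset.sum_le_card_nsmul T (fun i => 1 - z i) 1 fun i _ => by
      have := h0 i; simp [this]
  by_cases h : z ∈ ones S ∩ zeros T
  · rw [ind_of_mem h]
    linarith
  rw [ind_of_notMem h]
  by_cases hS1 : ∀ i ∈ S, z i = 1
  · have : ∃ i ∈ T, z i ≠ 0 := by
      by_contra! hc
      exact h ⟨⟨hz, hS1⟩, hz, hc⟩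
    obtain ⟨i, hi, hzi⟩ := this
    have hz1 := (hz i).resolve_left hzi
    have he : ∑ j ∈ T.erase i, (1 - z j) ≤ ((T.erase i).card : ℝ) := by
      simpa using Finset.sum_le_card_nsmul (T.erase i) (fun i => 1 - z i) 1 fun i _ => by
        have := h0 i; simp [this]
    have hc := Finset.card_erase_add_one hi
    rw [← Finset.add_sum_erase T _ hi, ← hc, hz1]
    push_cast
    linarith
  · push Not at hS1
    obtain ⟨i, hi, hzi⟩ := hS1
    have hz0 := (hz i).resolve_right hzi
    have he : ∑ j ∈ S.erase i, z j ≤ ((S.erase i).card : ℝ) := by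
      simpa using Finset.sum_le_card_nsmul (S.erase i) z 1 fun i _ => h1 i
    have hc := Finset.card_erase_add_one hi
    rw [← Finset.add_sum_erase S _ hi, ← hc, hz0]
    push_cast
    linarith

theorem moment_union_bound (hβ : IsIndex k β) (hpos : IsPositive k x β) (S T : Finset V) :
    ∑ i ∈ S, moment x (ones {i} ∩ β) + ∑ i ∈ T, moment x (zeros {i} ∩ β) -
        moment x (ones S ∩ zeros T ∩ β) ≤
      ((S.card : ℝ) + (T.card : ℝ) - 1) * moment x (cubeVertices V ∩ β) := by
  simp_rw [moment_inter_ones, moment_inter_zeros]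
  rw [moment_inter_cubeVertices, moment_inter, ← integral_sum, ← integral_sum,
    ← integral_add, ← integral_sub, ← integral_const_mul, ← sub_nonneg, ← integral_sub]
  set f : Option V → ℝ := fun o => ((S.card : ℝ) + (T.card : ℝ) - 1) * 1 -
    (∑ i ∈ S, atom o i + ∑ i ∈ T, (1 - atom o i) - ind (ones S ∩ zeros T) (atom o)) with hfdef
  have hf : ∀ o, 0 ≤ f o := fun o => by
    have := union_bound_pointwise (atom_mem_cubeVertices o) S T
    simp only [hfdef]
    linarith
  have hnone : f none = S.card - 1 + ind (ones S ∩ zeros T) 0 := by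
    simp only [hfdef, Finset.sum_sub_distrib, sum_atom_none]
    simp only [atom, Finset.sum_const, nsmul_eq_mul]
    ring
  have hsome : ∀ i, f (some i) = S.card - 1 - (if i ∈ S then 1 else 0) +
      (if i ∈ T then 1 else 0) + ind (ones S ∩ zeros T) (atom (some i)) := fun i => by
    simp only [hfdef, Finset.sum_sub_distrib, sum_atom_some, Finset.sum_const, nsmul_eq_mul]
    ring
  have hge : ∀ i, (S.card : ℝ) - 1 - (if i ∈ S then 1 else 0) ≤ f (some i) := fun i => by
    have := ind_nonneg (ones S ∩ zeros T) (atom (some i))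
    rw [hsome]
    split_ifs <;> linarith
  refine hpos f hf fun hV => ?_
  -- The slack at the origin is at most zero if `S` is empty and is `|S| - 1` otherwise. A unit
  -- vector outside `S` has slack at least `|S| - 1`, any unit vector at least `|S| - 2`; two of the
  -- latter suffice once `|S| ≥ 3`.
  by_cases hS : S = ∅
  · refine dominated_of_nonpos hf ?_
    have := ind_le_one (ones S ∩ zeros T) (0 : V → ℝ)
    rw [hnone, hS] at *
    simp only [Finset.card_empty, Nat.cast_zero]
    linarith
  have hnone' : f none = S.card - 1 := by
    rw [hnone, ind_of_notMem fun h => hS (zero_mem_ones.1 h.1), add_zero]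
  by_cases hS2 : S.card ≤ 2
  · refine dominated_of_one hf fun h0 => ?_
    obtain ⟨i, hi, hiβ⟩ := hβ.exists_atom_of_card_le hV h0 S (by omega)
    refine ⟨i, hiβ, ?_⟩
    have := hge i
    rw [if_neg hi] at this
    linarith
  · refine dominated_of_two hf fun h0 => ?_
    obtain ⟨i, j, hij, -, -, hi, hj⟩ := hβ.exists_two_atoms hV h0 ∅ (by simp)
    refine ⟨i, j, hij, hi, hj, ?_⟩
    have h3 : (3 : ℝ) ≤ S.card := by exact_mod_cast (by omega : 3 ≤ S.card)
    have h1 := hge i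
    have h2 := hge j
    split_ifs at h1 h2 <;> linarith

theorem below_count_pointwise {V : Type*} {z : V → ℝ} (hz : z ∈ cubeVertices V) (S T U : Finset V)
    (r : ℕ) : ((U.card : ℝ) - ((r : ℝ) - 1)) * ind (ones S ∩ zeros T ∩ below U r) z ≤
      ∑ i ∈ U, (1 - z i) := by
  by_cases h : z ∈ ones S ∩ zeros T ∩ below U r
  · rw [ind_of_mem h, mul_one, Finset.sum_sub_distrib, Finset.sum_const, nsmul_eq_mul, mul_one]
    have := h.2.2
    linarith
  · rw [ind_of_notMem h, mul_zero]
    exact Finset.sum_nonneg fun i _ => by rcases hz i with h | h <;> simp [h]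

/-- A variable that contains the origin and allows at most one `1` on `U` has `U` small. -/
theorem IsIndex.card_le_of_below_two {V : Type*} [DecidableEq V] {k : ℕ} {α : Set (V → ℝ)}
    (hα : IsIndex k α) (h0 : (0 : V → ℝ) ∈ α) {U : Finset V} (hU : α ⊆ below U 2) :
    U.card ≤ k + 3 := by
  obtain ⟨R, hR, h⟩ := hα.exists_pair_exceptions h0
  by_contra! hc
  -- Were `U` larger, two of its elements would avoid the exceptions, and their pair vector would
  -- lie in `α` with two ones on `U`.
  have h2 : 1 < (U \ R).card := by
    have := Finset.le_card_sdiff R U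
    omega
  obtain ⟨i, hi, j, hj, hij⟩ := Finset.one_lt_card.1 h2
  rw [Finset.mem_sdiff] at hi hj
  have := (hU (h i hi.2 j hj.2 hij)).2
  simp only [Pi.add_apply, Finset.sum_add_distrib, Finset.sum_pi_single', hi.1, hj.1,
    if_true] at this
  norm_num at this

theorem moment_below_count (hβ : IsIndex k β) (hpos : IsPositive k x β) {S T U : Finset V} {r : ℕ}
    (hα : IsIndex k (ones S ∩ zeros T ∩ below U r)) :
    ((U.card : ℝ) - ((r : ℝ) - 1)) * moment x (ones S ∩ zeros T ∩ below U r ∩ β) ≤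
      ∑ i ∈ U, moment x (zeros {i} ∩ β) := by
  have hsub : ones S ∩ zeros T ∩ below U r ⊆ below U r := fun _ h => h.2
  have hpw : ∀ z ∈ cubeVertices V,
      ((U.card : ℝ) - ((r : ℝ) - 1)) * ind (ones S ∩ zeros T ∩ below U r) z ≤
        ∑ i ∈ U, (1 - z i) := fun z hz => below_count_pointwise hz S T U r
  have hr1 : (0 : V → ℝ) ∈ ones S ∩ zeros T ∩ below U r → 1 ≤ r := fun h =>
    (zero_mem_below U).1 h.2
  -- A set may have several descriptions, so `U` and `r` need not be those that witness `IsIndex`.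
  -- From here on only `α ⊆ below U r` and the consequences of `IsIndex` are used.
  generalize ones S ∩ zeros T ∩ below U r = α at *
  simp_rw [moment_inter_zeros]
  rw [moment_inter, ← integral_sum, ← integral_const_mul, ← sub_nonneg, ← integral_sub]
  set f : Option V → ℝ := fun o => ∑ i ∈ U, (1 - atom o i) -
    ((U.card : ℝ) - ((r : ℝ) - 1)) * ind α (atom o) with hfdef
  have hf : ∀ o, 0 ≤ f o := fun o => sub_nonneg.2 (hpw _ (atom_mem_cubeVertices o))
  have hnone : f none = U.card - ((U.card : ℝ) - ((r : ℝ) - 1)) * ind α 0 := by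
    simp only [hfdef, Finset.sum_sub_distrib, sum_atom_none]
    simp [atom]
  have hsome : ∀ i, f (some i) = U.card - (if i ∈ U then 1 else 0) -
      ((U.card : ℝ) - ((r : ℝ) - 1)) * ind α (atom (some i)) := fun i => by
    simp only [hfdef, Finset.sum_sub_distrib, sum_atom_some]
    simp
  refine hpos f hf fun hV => ?_
  by_cases h0 : (0 : V → ℝ) ∈ α
  · rw [ind_of_mem h0] at hnone
    have hr := hr1 h0
    by_cases hr' : r = 1
    · refine dominated_of_nonpos hf ?_
      rw [hnone, hr']
      simp
    by_cases hr2 : r = 2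
    · subst hr2
      refine dominated_of_one hf fun h0β => ?_
      -- This case dictates `2k + 5`: a unit vector of `β` outside `U` is needed, and up to `(k + 3)
      -- + (k + 1)` indices are forbidden.
      have hUk := hα.card_le_of_below_two h0 hsub
      by_cases hU : U = ∅
      · obtain ⟨i, -, hiβ, hiα⟩ := hβ.exists_atom_inter h0β hα h0 ∅ (by simp; omega)
        refine ⟨i, hiβ, ?_⟩
        rw [hnone, hsome, ind_of_mem hiα, hU]
        simp
      · obtain ⟨i, hi, hiβ⟩ := hβ.exists_atom_of_card_le hV h0β U hUk
        refine ⟨i, hiβ, ?_⟩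
        have h1 : (1 : ℝ) ≤ U.card := by
          exact_mod_cast Finset.card_pos.2 (Finset.nonempty_iff_ne_empty.2 hU)
        rw [hnone, hsome, if_neg hi]
        have := mul_le_mul_of_nonneg_left (ind_le_one α (atom (some i)))
          (sub_nonneg.2 h1)
        push_cast
        linarith
    -- The origin has slack `r - 1` and a unit vector of `α` at least `r - 2`, so two of them
    -- suffice for `r ≥ 3`.
    · refine dominated_of_two hf fun h0β => ?_
      obtain ⟨i, -, hiβ, hiα⟩ := hβ.exists_atom_inter h0β hα h0 ∅ (by simp; omega)
      obtain ⟨j, hj, hjβ, hjα⟩ := hβ.exists_atom_inter h0β hα h0 {i} (by simp; omega)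
      refine ⟨i, j, fun h => hj (by simp [h]), hiβ, hjβ, ?_⟩
      rw [hnone, hsome, hsome, ind_of_mem hiα, ind_of_mem hjα]
      have h3 : (3 : ℝ) ≤ r := by exact_mod_cast (by omega : 3 ≤ r)
      split_ifs <;> linarith
  · rw [ind_of_notMem h0] at hnone
    obtain ⟨j, hj⟩ := hα.subset_ones h0
    have hsome' : ∀ i, i ≠ j → f (some i) = U.card - (if i ∈ U then 1 else 0) := fun i hij => by
      rw [hsome, ind_eq_zero_of_subset_ones hj hij, mul_zero, sub_zero]
    by_cases hU : U.card ≤ 1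
    · refine dominated_of_one hf fun h0β => ?_
      obtain ⟨i, hi, hiβ⟩ := hβ.exists_atom_of_card_le hV h0β (insert j U)
        ((Finset.card_insert_le _ _).trans (by omega))
      rw [Finset.mem_insert, not_or] at hi
      refine ⟨i, hiβ, ?_⟩
      rw [hsome' i hi.1, if_neg hi.2, hnone]
      linarith
    · refine dominated_of_two hf fun h0β => ?_
      obtain ⟨i, l, hil, hi, hl, hiβ, hlβ⟩ := hβ.exists_two_atoms hV h0β {j} (by simp)
      rw [Finset.mem_singleton] at hi hl
      refine ⟨i, l, hil, hiβ, hlβ, ?_⟩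
      have h2 : (2 : ℝ) ≤ U.card := by exact_mod_cast (by omega : 2 ≤ U.card)
      rw [hnone, hsome' i hi, hsome' l hl]
      split_ifs <;> linarith

theorem isBaseColumn_moment {Idx : Set (Set (V → ℝ))} (hIdx : ∀ α ∈ Idx, IsIndex k α)
    (hβ : IsIndex k β) (hpos : IsPositive k x β) :
    IsBaseColumn Idx (frac (⊤ : SimpleGraph V)) fun α => moment x (α ∩ β) where
  nonneg α hα := moment_inter_nonneg hβ hpos (hIdx α hα)
  le_total α hα := by
    obtain ⟨S, T, U, r, -, -, -, rfl⟩ := hIdx α hα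
    exact moment_inter_mono hβ hpos (hIdx _ hα) (fun _ h => h.1.1.1) (R := ∅) (by simp)
      fun _ _ _ => atom_mem_cubeVertices _
  hat_mem := hat_moment_inter_mem hβ hpos
  one_add_zero i := by
    rw [moment_inter_ones, moment_inter_zeros, moment_inter_cubeVertices, ← integral_add]
    exact integral_congr fun o => by ring
  le_one S T hα i hi := moment_inter_mono hβ hpos (hIdx _ hα)
    (fun z h => ⟨h.1.1, fun j hj => h.1.2 j (Finset.mem_singleton.1 hj ▸ hi)⟩) (R := ∅) (by simp)
    fun h => absurd (zero_mem_ones.1 h) (Finset.singleton_ne_empty i)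
  le_zero S T hα i hi := moment_inter_mono hβ hpos (hIdx _ hα)
    (fun z h => ⟨h.1.1, fun j hj => h.2.2 j (Finset.mem_singleton.1 hj ▸ hi)⟩) (R := {i}) (by simp)
    fun _ j hj => atom_some_mem_zeros.2 hj
  union_bound S T _ := moment_union_bound hβ hpos S T
  below_le_one S T U r hα i hi := moment_inter_mono hβ hpos (hIdx _ hα)
    (fun z h => ⟨h.1.1.1, fun j hj => h.1.1.2 j (Finset.mem_singleton.1 hj ▸ hi)⟩)
    (R := ∅) (by simp)
    fun h => absurd (zero_mem_ones.1 h) (Finset.singleton_ne_empty i)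
  below_le_zero S T U r hα i hi := moment_inter_mono hβ hpos (hIdx _ hα)
    (fun z h => ⟨h.1.1.1, fun j hj => h.1.2.2 j (Finset.mem_singleton.1 hj ▸ hi)⟩)
    (R := {i}) (by simp) fun _ j hj => atom_some_mem_zeros.2 hj
  below_count S T U r hα := moment_below_count hβ hpos (hIdx _ hα)

end Columns

/-! ### Moment matrices satisfy the constraints of both operators -/

section Lifts

variable {V : Type*} [Fintype V] [DecidableEq V] {k : ℕ} {x : V → ℝ} {α β : Set (V → ℝ)}

/-- For the second kind of variable `r = |U| - (k - |T|)`, so `|T| + |U| = k + r`, and `k < |U| +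
|T|` gives `r ≥ 1`. -/
theorem isIndex_of_mem_varsPrime {ι : Type*} {A : Matrix ι V ℝ} {b : ι → ℝ}
    (h : α ∈ varsPrime k A b) : IsIndex k α := by
  obtain ⟨S, -, ⟨T, -, hT, rfl⟩ | ⟨T, U, -, -, -, hT, hTU, rfl⟩⟩ := h
  · exact isIndex_ones_inter_zeros _ (by omega)
  · exact ⟨_, T, U, _, by omega, by omega, by omega, rfl⟩

theorem card_zeroPart_le {V : Type*} [DecidableEq V] {l : ℕ} (T : Fin l → Finset V) :
    (zeroPart T).card ≤ ∑ i, (T i).card :=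
  Finset.card_biUnion_le

theorem isIndex_of_mem_vars {ι : Type*} {A : Matrix ι V ℝ} {b : ι → ℝ}
    (h : α ∈ vars k A b) : IsIndex k α := by
  obtain rfl | ⟨i, rfl⟩ | ⟨i, rfl⟩ | ⟨l, -, W, T, ⟨-, -, hT⟩, rfl⟩ |
    ⟨l, -, W, T, W', T', -, -, hTW, hT, rfl⟩ := h
  · exact isIndex_cubeVertices k
  · exact isIndex_ones k _
  · exact isIndex_zeros (by simp)
  · exact isIndex_ones_inter_zeros _ (by have := card_zeroPart_le T; omega)
  · have h1 := card_zeroPart_le T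
    have h2 := Finset.card_lt_card hTW
    exact ⟨_, _, _, _, by omega, by omega, by omega, rfl⟩

/-- Any system whose refinement is `frac ⊤` admits moment matrices as columns. -/
theorem isColumnPrime_moment {ι : Type*} {A : Matrix ι V ℝ} {b : ι → ℝ}
    (hA : refined k A b = frac ⊤) (hβ : IsIndex k β) (hpos : IsPositive k x β) :
    IsColumnPrime k A b fun α => moment x (α ∩ β) where
  toIsBaseColumn := hA ▸ isBaseColumn_moment (fun _ => isIndex_of_mem_varsPrime) hβ hpos
  split S T _ i hi := by
    simp_rw [moment_inter]
    rw [← integral_add]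
    exact integral_congr fun o => ind_split (atom_mem_cubeVertices o) S T hi
  below_eq S T U r _ _ _ _ := by
    simp_rw [moment_inter]
    rw [← integral_sum, ← integral_sub]
    exact integral_congr fun o => ind_below_eq (atom_mem_cubeVertices o) S T U r

theorem isColumn_moment {ι : Type*} {A : Matrix ι V ℝ} {b : ι → ℝ}
    (hA : refined k A b = frac ⊤) (hβ : IsIndex k β) (hpos : IsPositive k x β) :
    IsColumn k A b fun α => moment x (α ∩ β) where
  toIsBaseColumn := hA ▸ isBaseColumn_moment (fun _ => isIndex_of_mem_vars) hβ hpos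
  full_sum l _ W T W' _ _ _ := by
    simp_rw [moment_inter]
    rw [← integral_sum]
    exact integral_congr fun o => sum_ind_powerset (atom_mem_cubeVertices o) _ W'
  partial_sum l _ W T W' hWT _ hk := by
    simp_rw [moment_inter]
    rw [← integral_sum, ← integral_add]
    have := hWT.2.2
    exact integral_congr fun o => sum_ind_add_below (atom_mem_cubeVertices o) _ W' (by omega)

theorem mem_bzPrime_of_isPositive (hpos : ∀ β, IsPositive k x β) :
    x ∈ bzPrime k (edgeMatrix (⊤ : SimpleGraph V)) (edgeRhs ⊤) := by
  refine ⟨fun α β => moment x (α ∩ β), ⟨?_, ?_, ?_, ?_, ?_⟩, hat_moment⟩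
  · intro α _ β _
    rw [Set.inter_comm]
  · rw [Set.inter_self, moment_cubeVertices]
  · intro β hβ
    exact isColumnPrime_moment (refined_top k) (isIndex_of_mem_varsPrime hβ) (hpos β)
  · intro α _ β _ h
    refine moment_eq_zero fun o ho => ?_
    rw [polytope_edgeMatrix] at h
    exact Set.notMem_empty (atom o) (h ▸
      ⟨⟨subset_convexHull ℝ α ho.1, subset_convexHull ℝ β ho.2⟩, atom_mem_frac o⟩)
  · intro α₁ _ β₁ _ α₂ _ β₂ _ h
    rw [h]

theorem mem_bz_of_isPositive (hpos : ∀ β, IsPositive k x β) :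
    x ∈ bz k (edgeMatrix (⊤ : SimpleGraph V)) (edgeRhs ⊤) := by
  refine ⟨fun α β => moment x (α ∩ β), ⟨?_, ?_, ?_, ?_, ?_⟩, hat_moment⟩
  · intro α _ β _
    rw [Set.inter_comm]
  · rw [Set.inter_self, moment_cubeVertices]
  · intro β hβ
    exact isColumn_moment (refined_top k) (isIndex_of_mem_vars hβ) (hpos β)
  · intro α _ β _ h
    refine moment_eq_zero fun o ho => ?_
    obtain h | ⟨O, hO, h⟩ := h
    · exact Set.notMem_empty (atom o) (h ▸ ho)
    · obtain ⟨u, v, huv, rfl⟩ := isObstruction_top_iff.1 hO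
      have hu := (h ho).2 u (by simp)
      have hv := (h ho).2 v (by simp)
      have := atom_add_le_one o huv
      rw [hu, hv] at this
      norm_num at this
  · intro α₁ _ β₁ _ α₂ _ β₂ _ h
    rw [h]

end Lifts

/-! ### The integer hull -/

section Hull

variable {V : Type*} [Fintype V]

theorem integerHull_frac_top_subset :
    integerHull (frac (⊤ : SimpleGraph V)) ⊆ {x | (∀ i, 0 ≤ x i) ∧ ∑ i, x i ≤ 1} := by
  refine convexHull_min ?_ ?_
  · rintro x ⟨⟨h01, he⟩, hc⟩
    refine ⟨fun i => (h01 i).1, ?_⟩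
    -- A 0-1 point satisfying all edge inequalities has at most one coordinate equal to one.
    by_cases h : ∃ i, x i = 1
    · obtain ⟨i, hi⟩ := h
      rw [Finset.sum_eq_single_of_mem i (Finset.mem_univ i), hi]
      intro j _ hj
      have h1 := he j i hj
      have h2 := (h01 j).1
      linarith
    · push Not at h
      rw [Finset.sum_eq_zero fun i _ => (hc i).resolve_right (h i)]
      exact zero_le_one
  · rw [convex_iff_forall_pos]
    rintro x ⟨hx, hsx⟩ y ⟨hy, hsy⟩ a b ha hb hab
    refine ⟨fun i => add_nonneg (mul_nonneg ha.le (hx i)) (mul_nonneg hb.le (hy i)), ?_⟩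
    simp only [Pi.add_apply, Pi.smul_apply, smul_eq_mul, Finset.sum_add_distrib,
      ← Finset.mul_sum]
    nlinarith

theorem integerHull_frac_top [DecidableEq V] :
    integerHull (frac (⊤ : SimpleGraph V)) = {x | (∀ i, 0 ≤ x i) ∧ ∑ i, x i ≤ 1} := by
  refine integerHull_frac_top_subset.antisymm ?_
  rintro x ⟨hx, hs⟩
  have hw : ∀ o ∈ (Finset.univ : Finset (Option V)), 0 ≤ weight x o := by
    intro o _
    cases o with
    | none => exact sub_nonneg.2 hs
    | some i => exact hx i
  have h1 : ∑ o, weight x o = 1 := by simp [Fintype.sum_option, weight]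
  have h2 : x = ∑ o, weight x o • atom o := by
    ext j
    simp [Fintype.sum_option, Finset.sum_apply, atom, weight, Pi.single_apply]
  exact Set.mem_of_eq_of_mem h2 ((convex_convexHull ℝ _).sum_mem hw h1
    fun o _ => subset_convexHull ℝ _ ⟨atom_mem_frac o, atom_mem_cubeVertices o⟩)

theorem outerPoint_notMem_integerHull [DecidableEq V] (hV : 2 ≤ Fintype.card V) :
    outerPoint V ∉ integerHull (frac (⊤ : SimpleGraph V)) := by
  intro h
  have := (integerHull_frac_top_subset h).2
  have h2 : (2 : ℝ) ≤ Fintype.card V := by exact_mod_cast hV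
  simp only [outerPoint, Finset.sum_const, Finset.card_univ, nsmul_eq_mul] at this
  rw [← div_eq_mul_inv, div_le_one (by linarith)] at this
  linarith

end Hull

/-! ### Integrality at high levels -/

section Upper

variable {V : Type*} [DecidableEq V]

theorem ones_inter_zeros_empty {V : Type*} (S : Finset V) :
    ones S ∩ zeros (∅ : Finset V) = ones S := by
  rw [zeros_empty]
  exact Set.inter_eq_left.2 fun _ h => h.1

theorem ones_empty_inter_zeros {V : Type*} (T : Finset V) :
    ones (∅ : Finset V) ∩ zeros T = zeros T := by
  rw [ones_empty]
  exact Set.inter_eq_right.2 fun _ h => h.1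

/-- The properties of the lifted matrices of both operators that force integrality. -/
structure IsSplitting (k : ℕ) (Idx : Set (Set (V → ℝ)))
    (Y : Set (V → ℝ) → Set (V → ℝ) → ℝ) : Prop where
  mem : ∀ S T : Finset V, Disjoint S T → S.card + T.card ≤ k → ones S ∩ zeros T ∈ Idx
  symm : ∀ α ∈ Idx, ∀ β ∈ Idx, Y α β = Y β α
  nonneg : ∀ α ∈ Idx, ∀ β ∈ Idx, 0 ≤ Y α β
  split : ∀ β ∈ Idx, ∀ (S T : Finset V) (i : V), Disjoint S T → i ∉ S → i ∉ T →
    S.card + T.card + 1 ≤ k →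
    Y (ones S ∩ zeros (insert i T)) β + Y (ones (insert i S) ∩ zeros T) β =
      Y (ones S ∩ zeros T) β
  eq_zero : ∀ α ∈ Idx, ∀ β ∈ Idx, ∀ u v, u ≠ v → α ⊆ ones {u} →
    (α ⊆ ones {v} ∨ β ⊆ ones {v}) → Y α β = 0

/-! ### Consequences of the splitting properties -/

namespace IsSplitting

variable {k : ℕ} {Idx : Set (Set (V → ℝ))} {Y : Set (V → ℝ) → Set (V → ℝ) → ℝ}
  {β : Set (V → ℝ)}

theorem zeros_mem (hY : IsSplitting k Idx Y) {T : Finset V} (hT : T.card ≤ k) :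
    zeros T ∈ Idx := by
  rw [← ones_empty_inter_zeros]
  exact hY.mem ∅ T (Finset.disjoint_empty_left T) (by simpa using hT)

theorem cubeVertices_mem (hY : IsSplitting k Idx Y) : cubeVertices V ∈ Idx := by
  rw [← zeros_empty]
  exact hY.zeros_mem (by simp)

theorem ones_singleton_mem (hY : IsSplitting k Idx Y) (hk : 1 ≤ k) (i : V) : ones {i} ∈ Idx := by
  rw [← ones_inter_zeros_empty]
  exact hY.mem {i} ∅ (Finset.disjoint_empty_right _) (by simpa using hk)

/-- Once coordinate `i` is one, the others are zero for free: splitting on `t ∈ T` leaves a piece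
with both `i` and `t` equal to one, whose entry vanishes. -/
theorem ones_singleton_inter_zeros (hY : IsSplitting k Idx Y) (hβ : β ∈ Idx) {i : V}
    {T : Finset V} (hi : i ∉ T) (hT : T.card + 1 ≤ k) :
    Y (ones {i} ∩ zeros T) β = Y (ones {i}) β := by
  induction T using Finset.induction_on with
  | empty => rw [ones_inter_zeros_empty]
  | insert t T ht ih =>
    rw [Finset.mem_insert, not_or] at hi
    rw [Finset.card_insert_of_notMem ht] at hT
    have h1 := hY.split β hβ {i} T t (by simpa using hi.2)
      (by simpa using fun h => hi.1 h.symm) ht (by rw [Finset.card_singleton]; omega)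
    have h2 : Y (ones (insert t {i}) ∩ zeros T) β = 0 := by
      refine hY.eq_zero _ (hY.mem _ _ ?_ ?_) β hβ i t hi.1 ?_ (Or.inl ?_)
      · simp [ht, hi.2]
      · rw [Finset.card_pair (Ne.symm hi.1)]; omega
      · exact fun z hz => ⟨hz.1.1, fun j hj => hz.1.2 j (Finset.mem_insert_of_mem hj)⟩
      · refine fun z hz => ⟨hz.1.1, fun j hj => hz.1.2 j ?_⟩
        rw [Finset.mem_singleton.1 hj]
        exact Finset.mem_insert_self _ _
    rw [h2, add_zero, ih hi.2 (by omega)] at h1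
    exact h1

/-- Inclusion-exclusion stops after the linear terms, because no two coordinates are one together.
-/
theorem zeros_eq (hY : IsSplitting k Idx Y) (hβ : β ∈ Idx) {T : Finset V} (hT : T.card ≤ k) :
    Y (zeros T) β = Y (cubeVertices V) β - ∑ i ∈ T, Y (ones {i}) β := by
  induction T using Finset.induction_on with
  | empty => rw [zeros_empty, Finset.sum_empty, sub_zero]
  | insert t T ht ih =>
    rw [Finset.card_insert_of_notMem ht] at hT
    have h1 := hY.split β hβ ∅ T t (Finset.disjoint_empty_left T) (Finset.notMem_empty t) ht
      (by rw [Finset.card_empty]; omega)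
    rw [insert_empty_eq, hY.ones_singleton_inter_zeros hβ ht hT, ones_empty_inter_zeros,
      ones_empty_inter_zeros, ih (by omega)] at h1
    rw [Finset.sum_insert ht]
    linarith

theorem sum_ones_le [Fintype V] (hY : IsSplitting k Idx Y)
    (hk : 1 ≤ k) (hV : Fintype.card V ≤ 2 * k) :
    ∑ i, Y (ones {i}) (cubeVertices V) ≤ Y (cubeVertices V) (cubeVertices V) := by
  have hF := hY.cubeVertices_mem
  have hones := hY.ones_singleton_mem hk
  obtain ⟨T, -, hT⟩ := Finset.exists_subset_card_eq
    (show Fintype.card V / 2 ≤ (Finset.univ : Finset V).card by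
      rw [Finset.card_univ]; omega)
  have hTk : T.card ≤ k := by omega
  have hTc : Tᶜ.card ≤ k := by rw [Finset.card_compl]; omega
  have hβ := hY.zeros_mem hTk
  have hβ' := hY.zeros_mem hTc
  -- By symmetry the column of `zeros T` can be expanded as a row; its cross terms `Y[i|₁, w|₁]`
  -- with `i ∈ T` vanish because `i ≠ w`.
  have h1 : ∀ w ∈ Tᶜ, Y (ones {w}) (zeros T) = Y (ones {w}) (cubeVertices V) := by
    intro w hw
    rw [hY.symm _ (hones w) _ hβ, hY.zeros_eq (hones w) hTk, hY.symm _ hF _ (hones w),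
      Finset.sum_eq_zero, sub_zero]
    intro i hi
    have hiw : i ≠ w := fun h => Finset.mem_compl.1 hw (h ▸ hi)
    exact hY.eq_zero _ (hones i) _ (hones w) i w hiw subset_rfl (Or.inr subset_rfl)
  -- The decisive inequality: expanding this entry in both arguments turns it into the total minus
  -- the sum over all vertices.
  have h2 := hY.nonneg _ hβ' _ hβ
  rw [hY.zeros_eq hβ hTc, Finset.sum_congr rfl h1, hY.symm _ hF _ hβ, hY.zeros_eq hF hTk] at h2
  rw [← Finset.sum_add_sum_compl T]
  linarith

end IsSplitting

/-! ### Both operators yield splitting matrices -/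

variable [Fintype V] {k : ℕ} {Y : Set (V → ℝ) → Set (V → ℝ) → ℝ}

/-- One singleton wall for each element of `S`. A tier asks for exactly `k` walls, so the rest are
filled up with copies of `{v}`. -/
theorem isTierPrime_of_card_le {ι : Type*} {A : Matrix ι V ℝ} {b : ι → ℝ}
    [Nonempty V] {S : Finset V} (hS : S.card ≤ k) : IsTierPrime k A b S := by
  obtain ⟨v⟩ := ‹Nonempty V›
  refine ⟨fun j => if h : j.1 < S.card then {(S.equivFin.symm ⟨j, h⟩).1} else {v},
    fun j => Or.inr ?_, fun w hw => ?_⟩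
  · by_cases h : j.1 < S.card
    · exact ⟨_, dif_pos h⟩
    · exact ⟨v, dif_neg h⟩
  · rw [Finset.mem_biUnion]
    have hlt := (S.equivFin ⟨w, hw⟩).2
    refine ⟨⟨S.equivFin ⟨w, hw⟩, by omega⟩, Finset.mem_univ _, ?_⟩
    simp

theorem LiftPrime.isSplitting [Nonempty V]
    (hY : LiftPrime k (edgeMatrix (⊤ : SimpleGraph V)) (edgeRhs ⊤) Y) :
    IsSplitting k (varsPrime k (edgeMatrix (⊤ : SimpleGraph V)) (edgeRhs ⊤)) Y := by
  have hmem : ∀ S T : Finset V, Disjoint S T → S.card + T.card ≤ k →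
      ones S ∩ zeros T ∈ varsPrime k (edgeMatrix (⊤ : SimpleGraph V)) (edgeRhs ⊤) := by
    intro S T hST hc
    refine ⟨S ∪ T, isTierPrime_of_card_le ((Finset.card_union_le S T).trans hc),
      Or.inl ⟨T, Finset.subset_union_right, by omega, ?_⟩⟩
    rw [Finset.union_sdiff_cancel_right hST]
  refine ⟨hmem, hY.symm, fun α hα β hβ => (hY.column β hβ).nonneg α hα, ?_, ?_⟩
  · intro β hβ S T i hST hiS hiT hc
    have := (hY.column β hβ).split S (insert i T) (hmem _ _ ?_ ?_) i
      (Finset.mem_insert_self i T)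
    · rwa [Finset.erase_insert hiT] at this
    · simp [hST, hiS]
    · rw [Finset.card_insert_of_notMem hiT]; omega
  · intro α hα β hβ u v huv hu hv
    refine hY.eq_zero α hα β hβ (Set.eq_empty_of_forall_notMem ?_)
    -- A coordinate constant on `γ` stays constant on its hull, so a common point of the hulls would
    -- have ones at both ends of the edge `uv`.
    have hconv : ∀ (γ : Set (V → ℝ)) (w : V), γ ⊆ ones {w} → ∀ z ∈ convexHull ℝ γ, z w = 1 := by
      intro γ w hγ z hz
      have h : Convex ℝ {z : V → ℝ | z w = 1} := by
        intro z hz z' hz' a b _ _ hab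
        simp only [Set.mem_ofPred_eq] at hz hz'
        simp [hz, hz', hab]
      exact convexHull_min (fun y hy => (hγ hy).2 w (Finset.mem_singleton_self w)) h hz
    rintro z ⟨⟨hzα, hzβ⟩, hz⟩
    rw [polytope_edgeMatrix] at hz
    have h1 := hconv α u hu z hzα
    have h2 : z v = 1 := hv.elim (fun h => hconv α v h z hzα) fun h => hconv β v h z hzβ
    have := hz.2 u v huv
    linarith

/-- Every face fixing few coordinates arises from a choice on singleton walls. -/
theorem exists_isChoice (hk : 1 ≤ k) (hV : 3 ≤ Fintype.card V) {S T : Finset V}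
    (hST : Disjoint S T) (hc : S.card + T.card ≤ k) :
    ∃ W U : Fin (S.card + T.card) → Finset V,
      IsChoice k (edgeMatrix (⊤ : SimpleGraph V)) (edgeRhs ⊤) W U ∧ onePart W U = S ∧
        zeroPart U = T ∧ ∑ i, (U i).card ≤ S.card + T.card := by
  obtain e := (S ∪ T).equivFinOfCardEq (Finset.card_union_of_disjoint hST)
  have hle : ∀ i, ((({(e.symm i).1} : Finset V)) ∩ T).card ≤ 1 := fun i =>
    (Finset.card_le_card Finset.inter_subset_left).trans (Finset.card_singleton _).le
  have hsum : ∑ i, ((({(e.symm i).1} : Finset V)) ∩ T).card ≤ S.card + T.card := by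
    refine (Finset.sum_le_sum fun i _ => hle i).trans ?_
    simp
  have he : ∀ v, v ∈ S ∪ T ↔ ∃ i, v = (e.symm i).1 := by
    intro v
    refine ⟨fun hv => ⟨e ⟨v, hv⟩, by simp⟩, ?_⟩
    rintro ⟨i, rfl⟩
    exact (e.symm i).2
  refine ⟨fun i => {(e.symm i).1}, fun i => {(e.symm i).1} ∩ T,
    ⟨fun i => isWall_singleton hk hV _, fun i => Finset.inter_subset_left, hsum.trans hc⟩,
    ?_, ?_, hsum⟩
  · ext v
    have h1 := he v
    have h2 : v ∈ S → v ∉ T := fun h h' => Finset.disjoint_left.1 hST h h'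
    simp only [onePart, Finset.mem_biUnion, Finset.mem_univ, true_and, Finset.mem_sdiff,
      Finset.mem_singleton, Finset.mem_inter, Finset.mem_union] at h1 ⊢
    grind
  · ext v
    have h1 := he v
    simp only [zeroPart, Finset.mem_biUnion, Finset.mem_univ, true_and,
      Finset.mem_singleton, Finset.mem_inter, Finset.mem_union] at h1 ⊢
    grind

theorem Lift.isSplitting (hk : 1 ≤ k) (hV : 3 ≤ Fintype.card V)
    (hY : Lift k (edgeMatrix (⊤ : SimpleGraph V)) (edgeRhs ⊤) Y) :
    IsSplitting k (vars k (edgeMatrix (⊤ : SimpleGraph V)) (edgeRhs ⊤)) Y := by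
  refine ⟨?_, hY.symm, fun α hα β hβ => (hY.column β hβ).nonneg α hα, ?_, ?_⟩
  · intro S T hST hc
    obtain ⟨W, U, hWU, hS, hT, -⟩ := exists_isChoice hk hV hST hc
    exact Or.inr (Or.inr (Or.inr (Or.inl ⟨_, hc, W, U, hWU, by rw [hS, hT]⟩)))
  · intro β hβ S T i hST hiS hiT hc
    obtain ⟨W, U, hWU, hS, hT, hU⟩ := exists_isChoice hk hV hST (k := k) (by omega)
    -- With the singleton `{i}` as last wall, the partition identity is the split on coordinate `i`.
    have := (hY.column β hβ).full_sum _ hc W U {i} hWU (isWall_singleton hk hV i)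
      (by rw [Finset.card_singleton]; omega)
    have hp : ({i} : Finset V).powerset = {∅, {i}} := by
      ext A
      simp [Finset.subset_singleton_iff]
    have h1 : ones S ∩ zeros T ∩ (ones ({i} \ ∅) ∩ zeros ∅) = ones (insert i S) ∩ zeros T := by
      ext z
      simp only [ones, zeros, Set.mem_inter_iff, Set.mem_ofPred_eq]
      grind
    have h2 : ones S ∩ zeros T ∩ (ones ({i} \ {i}) ∩ zeros {i}) =
        ones S ∩ zeros (insert i T) := by
      ext z
      simp only [ones, zeros, Set.mem_inter_iff, Set.mem_ofPred_eq]
      grind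
    rw [hS, hT, hp, Finset.sum_pair (Finset.singleton_ne_empty i).symm, h1, h2] at this
    rw [add_comm]
    exact this
  · intro α hα β hβ u v huv hu hv
    refine hY.eq_zero α hα β hβ (Or.inr ⟨{u, v}, isObstruction_top_iff.2 ⟨u, v, huv, rfl⟩, ?_⟩)
    rintro z ⟨hzα, hzβ⟩
    refine ⟨(hu hzα).1, fun j hj => ?_⟩
    rw [Finset.mem_insert, Finset.mem_singleton] at hj
    rcases hj with rfl | rfl
    · exact (hu hzα).2 j (Finset.mem_singleton_self j)
    · exact hv.elim (fun h => (h hzα).2 j (Finset.mem_singleton_self j))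
        fun h => (h hzβ).2 j (Finset.mem_singleton_self j)

/-- A relaxation of the complete graph given by splitting matrices is integral once `2 k` reaches
the number of vertices. -/
theorem IsSplitting.mem_integerHull {Idx : Set (Set (V → ℝ))} {x : V → ℝ}
    (hY : IsSplitting k Idx Y) (hk : 1 ≤ k) (hV : Fintype.card V ≤ 2 * k)
    (hx : hat (fun α => Y α (cubeVertices V)) = (1, x)) :
    x ∈ integerHull (frac (⊤ : SimpleGraph V)) := by
  obtain ⟨h1, h2⟩ := Prod.ext_iff.1 hx
  have h3 : ∀ i, Y (ones {i}) (cubeVertices V) = x i := fun i => congrFun h2 i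
  rw [integerHull_frac_top]
  refine ⟨fun i => ?_, ?_⟩
  · rw [← h3]
    exact hY.nonneg _ (hY.ones_singleton_mem hk i) _ hY.cubeVertices_mem
  · have := hY.sum_ones_le hk hV
    simp_rw [h3] at this
    exact this.trans h1.le

end Upper

/-! ### The rank of the complete graph -/

section Rank

variable {V : Type*} [Fintype V] [DecidableEq V] {k : ℕ}

theorem bzPrime_top_eq_integerHull (hV : 3 ≤ Fintype.card V) (hk : Fintype.card V ≤ 2 * k) :
    bzPrime k (edgeMatrix (⊤ : SimpleGraph V)) (edgeRhs ⊤) = integerHull (frac ⊤) := by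
  have : Nonempty V := Fintype.card_pos_iff.1 (by omega)
  refine Set.Subset.antisymm ?_ fun x hx => ?_
  · rintro x ⟨Y, hY, hx⟩
    exact hY.isSplitting.mem_integerHull (by omega) hk hx
  · have h := integerHull_frac_top_subset hx
    exact mem_bzPrime_of_isPositive (isPositive_of_mem_simplex h.1 h.2 k)

theorem bz_top_eq_integerHull (hV : 3 ≤ Fintype.card V) (hk : Fintype.card V ≤ 2 * k) :
    bz k (edgeMatrix (⊤ : SimpleGraph V)) (edgeRhs ⊤) = integerHull (frac ⊤) := by
  refine Set.Subset.antisymm ?_ fun x hx => ?_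
  · rintro x ⟨Y, hY, hx⟩
    exact (hY.isSplitting (by omega) hV).mem_integerHull (by omega) hk hx
  · have h := integerHull_frac_top_subset hx
    exact mem_bz_of_isPositive (isPositive_of_mem_simplex h.1 h.2 k)

theorem bzPrime_top_ne_integerHull (hV : 2 * k + 5 ≤ Fintype.card V) :
    bzPrime k (edgeMatrix (⊤ : SimpleGraph V)) (edgeRhs ⊤) ≠ integerHull (frac ⊤) := fun h =>
  outerPoint_notMem_integerHull (by omega)
    (h ▸ mem_bzPrime_of_isPositive (isPositive_outerPoint hV))

theorem bz_top_ne_integerHull (hV : 2 * k + 5 ≤ Fintype.card V) :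
    bz k (edgeMatrix (⊤ : SimpleGraph V)) (edgeRhs ⊤) ≠ integerHull (frac ⊤) := fun h =>
  outerPoint_notMem_integerHull (by omega)
    (h ▸ mem_bz_of_isPositive (isPositive_outerPoint hV))

theorem exists_isRank_of_bounds {V : Type*} {Γ : ℕ → Set (V → ℝ)} {P : Set (V → ℝ)} {n : ℕ}
    (hn : 3 ≤ n)
    (hup : ∀ k, n ≤ 2 * k → Γ k = integerHull P)
    (hlow : ∀ k, 2 * k + 5 ≤ n → Γ k ≠ integerHull P) :
    ∃ r : ℕ, IsRank Γ P r ∧ ⌈(n : ℚ) / 2⌉ - 2 ≤ (r : ℤ) ∧ (r : ℤ) ≤ ⌈((n : ℚ) + 1) / 2⌉ := by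
  -- For either parity of `n`, the integer `⌊n/2⌋ + 1` equals `⌈(n + 1)/2⌉`, the claimed upper
  -- bound.
  have hmem : n / 2 + 1 ∈ {k | 1 ≤ k ∧ Γ k = integerHull P} := ⟨by omega, hup _ (by omega)⟩
  have hleast := isLeast_csInf (α := ℕ) ⟨_, hmem⟩
  refine ⟨_, hleast, ?_, ?_⟩
  · have h : n ≤ 2 * sInf {k | 1 ≤ k ∧ Γ k = integerHull P} + 4 := by
      by_contra! hc
      exact hlow _ (by omega) hleast.1.2
    rw [sub_le_iff_le_add, Int.ceil_le, div_le_iff₀ two_pos]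
    have : (n : ℚ) ≤ 2 * ((sInf {k | 1 ≤ k ∧ Γ k = integerHull P} : ℕ) : ℚ) + 4 := by
      exact_mod_cast h
    push_cast
    linarith
  · refine le_trans (b := ((n / 2 + 1 : ℕ) : ℤ)) (by exact_mod_cast hleast.2 hmem) ?_
    have h : ((2 * (n / 2) : ℕ) : ℚ) ≤ (n : ℚ) := by exact_mod_cast Nat.mul_div_le n 2
    generalize n / 2 = m at h ⊢
    rw [Int.le_ceil_iff]
    push_cast at h ⊢
    linarith

end Rank

end LiftProject

end

theorem theorem8 (n : ℕ) (hn : 3 ≤ n) :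
    (∃ r : ℕ,
      LiftProject.IsRank
        (fun k => LiftProject.bzPrime k
          (LiftProject.edgeMatrix (⊤ : SimpleGraph (Fin n)))
          (LiftProject.edgeRhs (⊤ : SimpleGraph (Fin n))))
        (LiftProject.frac (⊤ : SimpleGraph (Fin n))) r ∧
      ⌈(n : ℚ) / 2⌉ - 2 ≤ (r : ℤ) ∧ (r : ℤ) ≤ ⌈((n : ℚ) + 1) / 2⌉) ∧
    (∃ r : ℕ,
      LiftProject.IsRank
        (fun k => LiftProject.bz k
          (LiftProject.edgeMatrix (⊤ : SimpleGraph (Fin n)))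
          (LiftProject.edgeRhs (⊤ : SimpleGraph (Fin n))))
        (LiftProject.frac (⊤ : SimpleGraph (Fin n))) r ∧
      ⌈(n : ℚ) / 2⌉ - 2 ≤ (r : ℤ) ∧ (r : ℤ) ≤ ⌈((n : ℚ) + 1) / 2⌉) := by
  have hV : Fintype.card (Fin n) = n := Fintype.card_fin n
  exact ⟨LiftProject.exists_isRank_of_bounds hn
      (fun _ h => LiftProject.bzPrime_top_eq_integerHull (by omega) (by omega))
      (fun _ h => LiftProject.bzPrime_top_ne_integerHull (by omega)),
    LiftProject.exists_isRank_of_bounds hn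
      (fun _ h => LiftProject.bz_top_eq_integerHull (by omega) (by omega))
      (fun _ h => LiftProject.bz_top_ne_integerHull (by omega))⟩
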